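/- Consider the following parameterized problem. An instance consists of a weighted forest $(G,w)$ (a finite acyclic simple graph $G$ with positive rational vertex weights $w$), a positive integer $r$, and a rational number $M\ge 0$; the parameter is $r$; the question is whether $\sigma(G,w;r)\le M$. Here $\sigma(G,w;r)$ is the minimum of $w(c)=\sum_{i=1}^{r}\max_{v\in S_i}w(v)$ over all proper $r$-colorings $c=(S_1,\dots,S_r)$ of $G$ (an empty color class has weight $0$), and $\sigma(G,w;r)=+\infty$ if $G$ has no proper $r$-coloring. This problem, the decision version of computing $\sigma(G,w;r)$ on weighted forests, is $\mathsf{W}[2]$-hard when parameterized by $r$. That is, there is a parameterized reduction to it from Dominating Set (given a finite graph $G$ and $k\in\mathbb{N}$, is there a set $S\subseteq V(G)$ with $|S|\le k$ and $N[S]=V(G)$?) parameterized by $k$: a map $f$ from instances to instances that preserves and reflects yes-instances, that is computed by a Turing machine in time $h(k)\cdot|I|^{c}$ on every instance $I$ with parameter $k$, for some computable function $h$ and some constant $c$, and for which the parameter of $f(I)$ is bounded by a computable function of $k$. Moreover, the reduction can be chosen such that the number of colors of the constructed instance is exactly $r=4k+4$. -/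

import Mathlib

open scoped NNReal ENNReal

/-! ### Weighted colorings -/

/-- The weight `max_{v ∈ S_i} w(v)` of the color `i` in a coloring `c` with `r` colors
(it is `0` if the color is not used). -/
def colorWeight {V : Type*} [Fintype V] {G : SimpleGraph V} {r : ℕ} (w : V → ℝ≥0)
    (c : G.Coloring (Fin r)) (i : Fin r) : ℝ≥0 :=
  (Finset.univ.filter fun v => c v = i).sup w

/-- The weight of a proper coloring with `r` colors: the sum of the weights of its colors. -/
def coloringWeight {V : Type*} [Fintype V] {G : SimpleGraph V} {r : ℕ} (w : V → ℝ≥0)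
    (c : G.Coloring (Fin r)) : ℝ≥0 :=
  ∑ i : Fin r, colorWeight w c i

/-- `σ(G, w; r)`: the minimum weight of a proper `r`-coloring of `G`, and `+∞` if `G` has no proper
`r`-coloring.  (There are finitely many `r`-colorings, so the infimum is a minimum if there is
one at all; the infimum over the empty family is `⊤` in `ℝ≥0∞`.) -/
noncomputable def sigma {V : Type*} [Fintype V] (G : SimpleGraph V) (w : V → ℝ≥0) (r : ℕ) : ℝ≥0∞ :=
  ⨅ c : G.Coloring (Fin r), (coloringWeight w c : ℝ≥0∞)

/-! ### Words over a finite alphabet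

Words are lists over the six letter alphabet `Computability.Γ'`, of which only the two bits and
the comma are used. -/

/-- A natural number in unary, closed by a comma. -/
def unaryWord (n : ℕ) : List Computability.Γ' :=
  List.replicate n (Computability.Γ'.bit true) ++ [Computability.Γ'.comma]

/-- A natural number in binary, closed by a comma. -/
def binaryWord (n : ℕ) : List Computability.Γ' :=
  (Computability.encodeNat n).map Computability.Γ'.bit ++ [Computability.Γ'.comma]

/-- A nonnegative rational number: the numerator and the denominator of its reduced fraction, both
in binary. -/
def ratWord (q : ℚ≥0) : List Computability.Γ' :=
  binaryWord q.num ++ binaryWord q.den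

open Classical in
/-- A graph on the vertices `0, …, n - 1`: its order in unary, then the rows of its adjacency
matrix. -/
noncomputable def graphWord {n : ℕ} (G : SimpleGraph (Fin n)) : List Computability.Γ' :=
  unaryWord n ++
    (List.finRange n).flatMap fun u =>
      (List.finRange n).map fun v => Computability.Γ'.bit (decide (G.Adj u v))

/-- The vertex weights, in the order of the vertices. -/
def weightsWord {n : ℕ} (w : Fin n → ℚ≥0) : List Computability.Γ' :=
  (List.finRange n).flatMap fun v => ratWord (w v)

/-! #### These encodings are uniquely readable -/

theorem bits_comma_inj {a b : List Bool} {s t : List Computability.Γ'}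
    (h : a.map Computability.Γ'.bit ++ Computability.Γ'.comma :: s =
      b.map Computability.Γ'.bit ++ Computability.Γ'.comma :: t) : a = b ∧ s = t := by
  induction a generalizing b with
  | nil => cases b <;> simp_all
  | cons x a ih =>
    cases b with
    | nil => simp at h
    | cons y b =>
      simp only [List.map_cons, List.cons_append, List.cons.injEq,
        Computability.Γ'.bit.injEq] at h
      obtain ⟨h1, h2⟩ := ih h.2
      exact ⟨by rw [h.1, h1], h2⟩

theorem unaryWord_inj {m n : ℕ} {s t : List Computability.Γ'}
    (h : unaryWord m ++ s = unaryWord n ++ t) : m = n ∧ s = t := by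
  have h' := bits_comma_inj (a := List.replicate m true) (b := List.replicate n true)
    (s := s) (t := t) (by simpa [unaryWord] using h)
  exact ⟨by simpa using congrArg List.length h'.1, h'.2⟩

theorem binaryWord_inj {m n : ℕ} {s t : List Computability.Γ'}
    (h : binaryWord m ++ s = binaryWord n ++ t) : m = n ∧ s = t := by
  have h' := bits_comma_inj (a := Computability.encodeNat m) (b := Computability.encodeNat n)
    (s := s) (t := t) (by simpa [binaryWord] using h)
  refine ⟨?_, h'.2⟩
  rw [← Computability.decode_encodeNat m, h'.1, Computability.decode_encodeNat]

theorem ratWord_inj {p q : ℚ≥0} {s t : List Computability.Γ'}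
    (h : ratWord p ++ s = ratWord q ++ t) : p = q ∧ s = t := by
  simp only [ratWord, List.append_assoc] at h
  obtain ⟨h1, h2⟩ := binaryWord_inj h
  obtain ⟨h3, h4⟩ := binaryWord_inj h2
  exact ⟨NNRat.ext_num_den h1 h3, h4⟩

theorem weights_flatMap_inj {ι : Type*} {w w' : ι → ℚ≥0} {s t : List Computability.Γ'}
    (l : List ι)
    (h : l.flatMap (fun v => ratWord (w v)) ++ s = l.flatMap (fun v => ratWord (w' v)) ++ t) :
    (∀ v ∈ l, w v = w' v) ∧ s = t := by
  induction l with
  | nil => simpa using h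
  | cons a l ih =>
    simp only [List.flatMap_cons, List.append_assoc] at h
    obtain ⟨h1, h2⟩ := ratWord_inj h
    obtain ⟨h3, h4⟩ := ih h2
    exact ⟨by simpa using ⟨h1, h3⟩, h4⟩

theorem rows_flatMap_inj {ι κ : Type*} {f g : ι → κ → Computability.Γ'}
    {s t : List Computability.Γ'} (l : List ι) (l' : List κ)
    (h : l.flatMap (fun u => l'.map (f u)) ++ s = l.flatMap (fun u => l'.map (g u)) ++ t) :
    (∀ u ∈ l, ∀ v ∈ l', f u v = g u v) ∧ s = t := by
  induction l with
  | nil => simpa using h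
  | cons a l ih =>
    simp only [List.flatMap_cons, List.append_assoc] at h
    obtain ⟨h1, h2⟩ := List.append_inj h (by simp)
    obtain ⟨h3, h4⟩ := ih h2
    refine ⟨?_, h4⟩
    simp only [List.mem_cons, forall_eq_or_imp]
    exact ⟨List.map_inj_left.1 h1, h3⟩

theorem graphWord_inj_order {m n : ℕ} {G : SimpleGraph (Fin m)} {H : SimpleGraph (Fin n)}
    {s t : List Computability.Γ'} (h : graphWord G ++ s = graphWord H ++ t) : m = n := by
  simp only [graphWord, List.append_assoc] at h
  exact (unaryWord_inj h).1

theorem graphWord_inj {n : ℕ} {G H : SimpleGraph (Fin n)}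
    {s t : List Computability.Γ'} (h : graphWord G ++ s = graphWord H ++ t) : G = H ∧ s = t := by
  simp only [graphWord, List.append_assoc] at h
  obtain ⟨h1, h2⟩ := rows_flatMap_inj _ _ (unaryWord_inj h).2
  refine ⟨?_, h2⟩
  ext u v
  simpa using h1 u (List.mem_finRange u) v (List.mem_finRange v)

/-! ### Parameterized problems and parameterized reductions -/

/-- A parameterized problem, given by its instances, the word that describes an instance, the
parameter, and the set of yes-instances.  A word and a parameter determine the instance. -/
structure ParamProblem where
  /-- the instances -/
  Inst : Type
  /-- the word that describes an instance -/
  encode : Inst → List Computability.Γ'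
  /-- the parameter of an instance -/
  param : Inst → ℕ
  encode_param_injective : Function.Injective fun I => (encode I, param I)
  /-- the yes-instances -/
  yes : Set Inst

namespace ParamProblem

/-- The input (or output) word of an algorithm for an instance `(x, k)`: the parameter `k` in unary,
followed by the word `x`. -/
def word (P : ParamProblem) (I : P.Inst) : List Computability.Γ' :=
  unaryWord (P.param I) ++ P.encode I

/-- The size `|I|` of an instance. -/
def size (P : ParamProblem) (I : P.Inst) : ℕ :=
  (P.word I).length

/-- `f` can be computed by a deterministic Turing machine in at most `h(k) * |I| ^ c` steps on each
instance `I` with parameter `k`, for some computable function `h` and some constant `c`. -/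
def ComputableInFPTTime (P Q : ParamProblem) (f : P.Inst → Q.Inst) : Prop :=
  ∃ (M : Turing.TM2ComputableAux Computability.Γ' Computability.Γ') (h : ℕ → ℕ) (c : ℕ),
    Computable h ∧
    ∀ I : P.Inst, Nonempty (Turing.TM2OutputsInTime M.tm
      ((P.word I).map M.inputAlphabet.invFun)
      (some ((Q.word (f I)).map M.outputAlphabet.invFun))
      (h (P.param I) * P.size I ^ c))

/-- `f` is a parameterized reduction from `P` to `Q`: it maps instances to equivalent instances, the
new parameter is bounded by a computable function of the old one, and `f` can be computed
in time `h(k) * |I| ^ c`. -/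
structure IsReduction (P Q : ParamProblem) (f : P.Inst → Q.Inst) : Prop where
  equivalent : ∀ I, f I ∈ Q.yes ↔ I ∈ P.yes
  param_le : ∃ g : ℕ → ℕ, Computable g ∧ ∀ I, Q.param (f I) ≤ g (P.param I)
  fpt_time : ComputableInFPTTime P Q f

end ParamProblem

/-! ### Dominating Set and `W[2]`-hardness -/

/-- An instance `(G, k)` of Dominating Set, where `G` is any finite graph. -/
structure DominatingSetInst where
  /-- the number of vertices -/
  n : ℕ
  /-- the graph -/
  G : SimpleGraph (Fin n)
  /-- the bound on the size of the dominating set -/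
  k : ℕ

/-- Dominating Set, parameterized by the size of the solution: given `G` and `k`, is there a set `S`
of at most `k` vertices with `N[S] = V(G)`? -/
noncomputable def dominatingSet : ParamProblem where
  Inst := DominatingSetInst
  encode I := graphWord I.G
  param I := I.k
  encode_param_injective := by
    rintro ⟨m, G, k⟩ ⟨n, H, l⟩ h
    simp only [Prod.mk.injEq] at h
    obtain ⟨h1, rfl⟩ := h
    have h2 : graphWord G ++ [] = graphWord H ++ [] := by simpa using h1
    obtain rfl := graphWord_inj_order h2
    obtain ⟨rfl, -⟩ := graphWord_inj h2
    rfl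
  yes := {I | ∃ S : Finset (Fin I.n), S.card ≤ I.k ∧ ∀ v, v ∈ S ∨ ∃ u ∈ S, I.G.Adj u v}

/-- A parameterized problem is `W[2]`-hard if there is a parameterized reduction to it from Dominating
Set parameterized by the size of the solution. -/
def W2Hard (Q : ParamProblem) : Prop :=
  ∃ f : dominatingSet.Inst → Q.Inst, dominatingSet.IsReduction Q f

/-! ### The problem of computing `σ(G, w; r)` on forests -/

/-- An instance of the problem of computing `σ(G, w; r)` on forests: a weighted forest `(G, w)` with
positive rational weights, a positive number `r` of colors, and a target value `M`. -/
structure ForestColoringInst where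
  /-- the number of vertices -/
  n : ℕ
  /-- the forest -/
  G : SimpleGraph (Fin n)
  isAcyclic : G.IsAcyclic
  /-- the weights -/
  w : Fin n → ℚ≥0
  w_pos : ∀ v, 0 < w v
  /-- the number of colors -/
  r : ℕ
  r_pos : 0 < r
  /-- the target value -/
  M : ℚ≥0

/-- The problem of computing `σ(G, w; r)` for a weighted forest `(G, w)`, parameterized by `r`, as
a decision problem: is `σ(G, w; r) ≤ M`? -/
noncomputable def forestColoring : ParamProblem where
  Inst := ForestColoringInst
  encode I := graphWord I.G ++ (weightsWord I.w ++ ratWord I.M)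
  param I := I.r
  encode_param_injective := by
    rintro ⟨m, G, hG, w, hw, r, hr, M⟩ ⟨n, H, hH, w', hw', r', hr', M'⟩ h
    simp only [Prod.mk.injEq] at h
    obtain ⟨h1, rfl⟩ := h
    obtain rfl := graphWord_inj_order h1
    obtain ⟨rfl, h2⟩ := graphWord_inj h1
    obtain ⟨h3, h4⟩ := weights_flatMap_inj _ h2
    obtain rfl : w = w' := funext fun v => h3 v (List.mem_finRange v)
    have h5 : ratWord M ++ [] = ratWord M' ++ [] := by simpa using h4
    obtain ⟨rfl, -⟩ := ratWord_inj h5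
    rfl
  yes := {I | sigma I.G (fun v => (I.w v : ℝ≥0)) I.r ≤ ((I.M : ℝ≥0) : ℝ≥0∞)}

/-! There are `r = 4k+4` colors, with levels that halve from one color to the next; the target is
the sum of the levels plus a slack of `k(n-1)`, and it is less than twice `level 0`. A block is a
binomial tree on `2^r` vertices: the parent of `s ≠ 0` is obtained by clearing the lowest one bit,
so a vertex of 2-adic valuation `j` has a child of each smaller valuation, and an ordinary vertex of
valuation `j` weighs `level j`. Sort the colors of a coloring that meets the target by decreasing
weight. The children exclude colors below `j`, and a color above `j` would be too light, since
otherwise the target is exceeded; so valuation `j` forces color `j` (`standard_aux`). Detaching the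
subtree at a child of the root releases the color of that child for the root.

Slot `i < k` of the solution holds a vertex `x i`, encoded by the excess of two colors over their
levels: `n-1-x i` for `1+k+i`, and `x i` for `1+2k+i`. A gadget for slot `i` and vertex `u` is a
block whose root may take the colors `0` and `1+k+i`, and also `1+i` in a row `v < n`. Color `0`
pushes the switch vertex `2^(1+2k+i)` to color `1+2k+i` with excess at least `u+1`; color `1+k+i`
costs an excess of `n-u`, or only `n-1-u` in the extra row `n`. The extra row forces a choice `x i`
(`exists_choice`), and the slack makes the excesses exact (`choice_eq`). In a row `v < n` the gadget
of `x i` can then afford neither, so its root has color `1+i`. The root of the row has one of the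
colors `1, …, k` (`col_root`), and it is adjacent to the gadget roots of all `u` that do not
dominate `v`; so if its color is `1+i`, then `x i` dominates `v`. Conversely, `domColor` turns a
dominating set into a coloring.

For the running time, a small language of stack programs is compiled to `TM2` machines (`run_code`),
and closure properties of `PolyFun` and `Emits` cover all ingredients of the forest. The forest has
size polynomial in `k`, `n` and `16^(k+1) = 2^r`. Once this last number is written in unary,
everything takes polynomial time, and its contribution is absorbed in `h(k)`
(`Emits.exists_machine`). -/

/-! ### Structured programs on stacks -/

/-- Programs on stacks indexed by natural numbers. -/
inductive StackProg
  | nop : StackProg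
  | push (i : ℕ) (a : Computability.Γ') : StackProg
  | seq (c d : StackProg) : StackProg
  | case (i : ℕ) (f : Option Computability.Γ' → StackProg) : StackProg
  | loop (i : ℕ) (p : Computability.Γ' → Bool) (f : Computability.Γ' → StackProg) : StackProg

namespace StackProg

open Computability (Γ')

/-- The contents of the stacks. -/
abbrev Store := ℕ → List Γ'

/-- `c.Run s t s'`: the program `c` takes the stacks `s` to `s'` in `t` steps.  A loop pops a letter from
the stack `i` and continues as long as there is one, and it satisfies `p`. -/
inductive Run : StackProg → Store → ℕ → Store → Prop
  | nop (s) : Run nop s 1 s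
  | push (i a s) : Run (push i a) s 1 (Function.update s i (a :: s i))
  | seq {c d s t s' t' s''} : Run c s t s' → Run d s' t' s'' → Run (seq c d) s (t + t') s''
  | case {i f s t s'} : Run (f (s i).head?) (Function.update s i (s i).tail) t s' →
      Run (case i f) s (t + 1) s'
  | loop_exit {i p f s} : (∀ a, (s i).head? = some a → p a = false) →
      Run (loop i p f) s 1 (Function.update s i (s i).tail)
  | loop_step {i p f s a l t s' t' s''} : s i = a :: l → p a = true →
      Run (f a) (Function.update s i l) t s' →
      Run (loop i p f) s' t' s'' → Run (loop i p f) s (t + 1 + t') s''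

/-- The labels of the machine that executes a program. -/
def Label : StackProg → Type
  | nop => Unit
  | push _ _ => Unit
  | seq c d => Label c ⊕ Label d
  | case _ f => Option (Σ o, Label (f o))
  | loop _ _ f => Option (Σ a, Label (f a))

noncomputable instance fintypeLabel : (c : StackProg) → Fintype (Label c)
  | nop => inferInstanceAs (Fintype Unit)
  | push _ _ => inferInstanceAs (Fintype Unit)
  | seq c d =>
    letI := fintypeLabel c
    letI := fintypeLabel d
    inferInstanceAs (Fintype (Label c ⊕ Label d))
  | case _ f =>
    letI := fun o => fintypeLabel (f o)
    inferInstanceAs (Fintype (Option (Σ o, Label (f o))))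
  | loop _ _ f =>
    letI := fun o => fintypeLabel (f o)
    inferInstanceAs (Fintype (Option (Σ a, Label (f a))))

/-- The label where the execution of a program starts. -/
def entry : (c : StackProg) → Label c
  | nop => ()
  | push _ _ => ()
  | seq c _ => Sum.inl (entry c)
  | case _ _ => none
  | loop _ _ _ => none

/-- A bound for the indices of the stacks which a program uses. -/
def bound : StackProg → ℕ
  | nop => 0
  | push i _ => i
  | seq c d => max (bound c) (bound d)
  | case i f => max i (Finset.univ.sup fun o => bound (f o))
  | loop i _ f => max i (Finset.univ.sup fun a => bound (f a))

/-- The statements of a machine with stacks `0, …, m`. -/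
abbrev MStmt (m : ℕ) (Λ : Type) := Turing.TM2.Stmt (fun _ : Fin (m + 1) => Γ') Λ (Option Γ')

/-- The statement at each label of a program; `out` is the label where the execution continues after
the program, and `emb` embeds the labels of the program into those of the machine. -/
def code (m : ℕ) {Λ : Type} : (c : StackProg) → (out : Λ) → (emb : Label c → Λ) →
    Label c → MStmt m Λ
  | nop, out, _, _ => Turing.TM2.Stmt.goto fun _ => out
  | push i a, out, _, _ =>
    Turing.TM2.Stmt.push (Fin.ofNat (m + 1) i) (fun _ => a) (Turing.TM2.Stmt.goto fun _ => out)
  | seq c d, out, emb, l =>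
    match l with
    | Sum.inl l => code m c (emb (Sum.inr (entry d))) (fun l => emb (Sum.inl l)) l
    | Sum.inr l => code m d out (fun l => emb (Sum.inr l)) l
  | case i f, out, emb, l =>
    match l with
    | none => Turing.TM2.Stmt.pop (Fin.ofNat (m + 1) i) (fun _ o => o)
        (Turing.TM2.Stmt.goto fun o => emb (some ⟨o, entry (f o)⟩))
    | some ⟨o, l⟩ => code m (f o) out (fun l => emb (some ⟨o, l⟩)) l
  | loop i p f, out, emb, l =>
    match l with
    | none => Turing.TM2.Stmt.pop (Fin.ofNat (m + 1) i) (fun _ o => o) (Turing.TM2.Stmt.goto fun o =>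
        match o with
        | none => out
        | some a => if p a then emb (some ⟨a, entry (f a)⟩) else out)
    | some ⟨a, l⟩ => code m (f a) (emb none) (fun l => emb (some ⟨a, l⟩)) l

/-- The part of the stacks that a machine with stacks `0, …, m` has. -/
def restrict (m : ℕ) (s : Store) : Fin (m + 1) → List Γ' := fun i => s i

theorem restrict_ofNat {m i : ℕ} (h : i ≤ m) (s : Store) :
    restrict m s (Fin.ofNat (m + 1) i) = s i := by
  simp [restrict, Nat.mod_eq_of_lt (Nat.lt_succ_of_le h)]

theorem update_restrict {m i : ℕ} (h : i ≤ m) (s : Store) (l : List Γ') :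
    Function.update (restrict m s) (Fin.ofNat (m + 1) i) l = restrict m (Function.update s i l) := by
  funext j
  by_cases hj : j = Fin.ofNat (m + 1) i
  · subst hj
    simp [restrict, Nat.mod_eq_of_lt (Nat.lt_succ_of_le h)]
  · rw [Function.update_of_ne hj, restrict, restrict, Function.update_of_ne]
    rintro rfl
    exact hj (by ext; simp)

/-- Iterated execution of the steps of a machine. -/
theorem iterate_step_add {σ : Type*} {f : σ → Option σ} {a b c : Option σ} {m n : ℕ}
    (h : (flip bind f)^[m] a = b) (h' : (flip bind f)^[n] b = c) :
    (flip bind f)^[m + n] a = c := by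
  rw [add_comm, Function.iterate_add_apply, h, h']

/-- The constructors of `Run` charge exactly one unit per machine step, so induction on the
execution gives the exact step count. The internal state is the last letter popped; it is irrelevant
between programs, hence arbitrary before and existential after. General `out` and `emb` allow a
program to sit anywhere inside a larger machine. -/
theorem run_code {m : ℕ} {Λ : Type} (mach : Λ → MStmt m Λ) {c : StackProg} {s : Store} {t : ℕ}
    {s' : Store} (h : Run c s t s') : c.bound ≤ m → ∀ (out : Λ) (emb : Label c → Λ),
    (∀ l, mach (emb l) = code m c out emb l) → ∀ v, ∃ v',
      (flip bind (Turing.TM2.step mach))^[t] (some ⟨some (emb (entry c)), v, restrict m s⟩) =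
        some ⟨some out, v', restrict m s'⟩ := by
  induction h with
  | nop s =>
    intro _ out emb h v
    exact ⟨v, by simp [flip, Turing.TM2.step, h, code]⟩
  | push i a s =>
    intro hb out emb h v
    refine ⟨v, ?_⟩
    have hi : i ≤ m := hb
    simp only [Function.iterate_one, flip, Option.bind_eq_bind, Option.bind_some, Turing.TM2.step, h,
      code, Turing.TM2.stepAux, update_restrict hi, restrict_ofNat hi]
  | seq _ _ ih1 ih2 =>
    intro hb out emb h v
    simp only [bound, max_le_iff] at hb
    obtain ⟨v1, h1⟩ := ih1 hb.1 _ (fun l => emb (Sum.inl l)) (fun l => h (Sum.inl l)) v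
    obtain ⟨v2, h2⟩ := ih2 hb.2 _ (fun l => emb (Sum.inr l)) (fun l => h (Sum.inr l)) v1
    exact ⟨v2, iterate_step_add h1 h2⟩
  | @case i f s t s' _ ih =>
    intro hb out emb h v
    simp only [bound, max_le_iff, Finset.sup_le_iff] at hb
    obtain ⟨v1, h1⟩ := ih (hb.2 _ (Finset.mem_univ _)) out (fun l => emb (some ⟨_, l⟩))
      (fun l => h (some ⟨_, l⟩)) (s i).head?
    refine ⟨v1, ?_⟩
    rw [add_comm t 1]
    refine iterate_step_add (m := 1) ?_ h1
    have h0 := h none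
    simp only [code] at h0
    simp only [Function.iterate_one, flip, Option.bind_eq_bind, Option.bind_some, Turing.TM2.step,
      entry, h0, Turing.TM2.stepAux, restrict_ofNat hb.1, update_restrict hb.1]
    rw [restrict_ofNat hb.1]
  | @loop_exit i p f s hs =>
    intro hb out emb h v
    simp only [bound, max_le_iff, Finset.sup_le_iff] at hb
    refine ⟨(s i).head?, ?_⟩
    have h0 := h none
    simp only [code] at h0
    simp only [Function.iterate_one, flip, Option.bind_eq_bind, Option.bind_some, Turing.TM2.step,
      entry, h0, Turing.TM2.stepAux, restrict_ofNat hb.1, update_restrict hb.1]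
    cases hh : (s i).head? with
    | none => rfl
    | some a => simp [hs a hh]
  | @loop_step i p f s a l t s' t' s'' hs hp _ _ ih1 ih2 =>
    intro hb out emb h v
    have hb' := hb
    simp only [bound, max_le_iff, Finset.sup_le_iff] at hb
    obtain ⟨v1, h1⟩ := ih1 (hb.2 _ (Finset.mem_univ _)) (emb none) (fun l => emb (some ⟨_, l⟩))
      (fun l => h (some ⟨_, l⟩)) (some a)
    obtain ⟨v2, h2⟩ := ih2 hb' out emb h v1
    refine ⟨v2, ?_⟩
    rw [add_comm t 1]
    refine iterate_step_add (iterate_step_add (m := 1) ?_ h1) h2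
    have h0 := h none
    simp only [code] at h0
    simp only [Function.iterate_one, flip, Option.bind_eq_bind, Option.bind_some, Turing.TM2.step,
      entry, h0, Turing.TM2.stepAux, restrict_ofNat hb.1, update_restrict hb.1, hs, hp,
      List.head?_cons, List.tail_cons, if_true]

/-- The machine that executes a program, with input stack `0` and output stack `1`. -/
noncomputable def toMachine (c : StackProg) : Turing.FinTM2 where
  -- One stack more than `bound` requires, so that the output stack `1` exists even if `c.bound =
  -- 0`.
  K := Fin (c.bound + 1 + 1)
  k₀ := 0
  k₁ := 1
  Γ := fun _ => Γ'
  Λ := Option (Label c)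
  main := some (entry c)
  σ := Option Γ'
  initialState := none
  m l :=
    match l with
    -- `Turing.haltList` prescribes the initial internal state, so the last letter popped is erased
    -- before halting.
    | none => Turing.TM2.Stmt.load (fun _ => none) Turing.TM2.Stmt.halt
    | some l => code (c.bound + 1) c none some l

/-- The stacks with `x` on the stack `i` and nothing else. -/
def Store.single (i : ℕ) (x : List Γ') : Store := Function.update (fun _ => []) i x

theorem Store.single_of_ne {i j : ℕ} (h : j ≠ i) (x : List Γ') : Store.single i x j = [] :=
  Function.update_of_ne h _ _

theorem toMachine_outputs {c : StackProg} {x y : List Γ'} {t T : ℕ}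
    (h : Run c (Store.single 0 x) t (Store.single 1 y)) (hT : t + 1 ≤ T) :
    Nonempty (Turing.TM2OutputsInTime c.toMachine x (some y) T) := by
  obtain ⟨v, hv⟩ := run_code c.toMachine.m h (Nat.le_succ _) none some (fun _ => rfl) none
  refine ⟨⟨⟨t + 1, ?_⟩, hT⟩⟩
  have h0 : Turing.initList c.toMachine x =
      ⟨some (some (entry c)), none, restrict _ (Store.single 0 x)⟩ := by
    refine congrArg (Turing.TM2.Cfg.mk _ _) (funext fun (k : Fin (c.bound + 1 + 1)) => ?_)
    by_cases hk : k = (0 : Fin (c.bound + 1 + 1))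
    · subst hk
      exact dif_pos rfl
    · have : (k : ℕ) ≠ 0 := fun h => hk (Fin.ext h)
      exact (dif_neg hk).trans (Store.single_of_ne this _).symm
  have h1 : Turing.haltList c.toMachine y =
      ⟨none, none, restrict (c.bound + 1) (Store.single 1 y)⟩ := by
    refine congrArg (Turing.TM2.Cfg.mk _ _) (funext fun (k : Fin (c.bound + 1 + 1)) => ?_)
    by_cases hk : k = (1 : Fin (c.bound + 1 + 1))
    · subst hk
      exact dif_pos rfl
    · have : (k : ℕ) ≠ 1 := fun h => hk (Fin.ext (by simpa using h))
      exact (dif_neg hk).trans (Store.single_of_ne this _).symm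
  have h2 := iterate_step_add (n := 1)
    (c := some ⟨none, none, restrict (c.bound + 1) (Store.single 1 y)⟩) hv rfl
  rw [h0]
  exact h2.trans (congrArg some h1.symm)

/-! ### Running times of some programs -/

/-- The program `c` takes the stacks `s` to `s'` in at most `T` steps. -/
def RunLE (c : StackProg) (s : Store) (T : ℕ) (s' : Store) : Prop := ∃ t ≤ T, Run c s t s'

namespace RunLE

theorem mono {c s T T' s'} (h : RunLE c s T s') (hT : T ≤ T') : RunLE c s T' s' :=
  let ⟨t, ht, hr⟩ := h
  ⟨t, ht.trans hT, hr⟩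

theorem of_eq {c s T s' s₀ T' s₁} (h : RunLE c s T s') (h0 : s₀ = s) (hT : T ≤ T') (h1 : s' = s₁) :
    RunLE c s₀ T' s₁ := by
  subst h0 h1
  exact h.mono hT

theorem nop (s : Store) : RunLE .nop s 1 s := ⟨1, le_rfl, .nop s⟩

theorem push (i a) (s : Store) : RunLE (.push i a) s 1 (Function.update s i (a :: s i)) :=
  ⟨1, le_rfl, .push i a s⟩

theorem seq {c d s T s' T' s''} (h : RunLE c s T s') (h' : RunLE d s' T' s'') :
    RunLE (.seq c d) s (T + T') s'' :=
  let ⟨_, ht, hr⟩ := h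
  let ⟨_, ht', hr'⟩ := h'
  ⟨_, add_le_add ht ht', hr.seq hr'⟩

theorem case {i f s T s'} (h : RunLE (f (s i).head?) (Function.update s i (s i).tail) T s') :
    RunLE (.case i f) s (T + 1) s' :=
  let ⟨_, ht, hr⟩ := h
  ⟨_, Nat.succ_le_succ ht, hr.case⟩

theorem loop_exit {i p f} {s : Store} (h : ∀ a, (s i).head? = some a → p a = false) :
    RunLE (.loop i p f) s 1 (Function.update s i (s i).tail) :=
  ⟨1, le_rfl, .loop_exit h⟩

theorem loop_step {i p f} {s : Store} {a l T s' T' s''} (hs : s i = a :: l) (hp : p a = true)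
    (h : RunLE (f a) (Function.update s i l) T s') (h' : RunLE (.loop i p f) s' T' s'') :
    RunLE (.loop i p f) s (T + 1 + T') s'' :=
  let ⟨_, ht, hr⟩ := h
  let ⟨_, ht', hr'⟩ := h'
  ⟨_, by omega, .loop_step hs hp hr hr'⟩

end RunLE

/-- A natural number in unary. -/
def un (n : ℕ) : List Γ' := List.replicate n (Γ'.bit true)

theorem un_zero : un 0 = [] := rfl

theorem un_succ (n : ℕ) : un (n + 1) = Γ'.bit true :: un n := rfl

theorem length_un (n : ℕ) : (un n).length = n := List.length_replicate

theorem reverse_un (n : ℕ) : (un n).reverse = un n := List.reverse_replicate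

theorem un_append (m n : ℕ) : un m ++ un n = un (m + n) := List.replicate_append_replicate

/-- The family `S` is the loop invariant: `S j` is the state after `j` rounds. The letter that ends
the loop is popped as well, so one loop reads a number together with its comma. -/
theorem RunLE.loop_unary {i p f} {n T : ℕ} {l : List Γ'} (S : ℕ → Store)
    (hS : ∀ j ≤ n, S j i = un (n - j) ++ l) (hp : p (Γ'.bit true) = true)
    (hl : ∀ a, l.head? = some a → p a = false)
    (step : ∀ j < n, RunLE (f (Γ'.bit true)) (Function.update (S j) i (un (n - (j + 1)) ++ l)) T
      (S (j + 1))) :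
    RunLE (.loop i p f) (S 0) (n * (T + 1) + 1) (Function.update (S n) i l.tail) := by
  suffices H : ∀ m ≤ n, RunLE (.loop i p f) (S (n - m)) (m * (T + 1) + 1)
      (Function.update (S n) i l.tail) by simpa using H n le_rfl
  intro m
  induction m with
  | zero =>
    intro _
    have h0 : S n i = l := by simpa [un_zero] using hS n le_rfl
    have := RunLE.loop_exit (i := i) (p := p) (f := f) (s := S n) (by rwa [h0])
    rw [h0] at this
    simpa using this
  | succ m ih =>
    intro hm
    have h1 := step (n - (m + 1)) (by omega)
    have h2 := hS (n - (m + 1)) (by omega)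
    have e1 : n - (m + 1) + 1 = n - m := by omega
    have e2 : n - (n - (m + 1)) = m + 1 := by omega
    have e3 : n - (n - m) = m := by omega
    rw [e2, un_succ] at h2
    rw [e1, e3] at h1
    refine (RunLE.loop_step h2 hp h1 (ih (by omega))).mono (le_of_eq ?_)
    ring

/-- Execute a program as often as the length of a stack, and empty this stack. -/
def drain (i : ℕ) (c : StackProg) : StackProg := .loop i (fun _ => true) fun _ => c

theorem RunLE.drain {i c} {n T : ℕ} (S : ℕ → Store) (hS : ∀ j ≤ n, S j i = un (n - j))
    (step : ∀ j < n, RunLE c (Function.update (S j) i (un (n - (j + 1)))) T (S (j + 1))) :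
    RunLE (drain i c) (S 0) (n * (T + 1) + 1) (S n) := by
  have := RunLE.loop_unary (p := fun _ => true) (f := fun _ => c) (l := []) S (by simpa using hS) rfl
    (by simp) (by simpa using step)
  have h0 : S n i = [] := by simpa [un_zero] using hS n le_rfl
  rwa [List.tail_nil, ← h0, Function.update_eq_self] at this

/-- Move a stack onto another one, letter by letter. -/
def move (i j : ℕ) : StackProg := .loop i (fun _ => true) fun a => .push j a

theorem RunLE.move {i j : ℕ} (hij : i ≠ j) (s : Store) :
    RunLE (move i j) s ((s i).length * 2 + 1)
      (Function.update (Function.update s i []) j ((s i).reverse ++ s j)) := by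
  generalize hl : s i = l
  induction l generalizing s with
  | nil =>
    have := RunLE.loop_exit (i := i) (p := fun _ => true) (f := fun a => .push j a) (s := s)
      (by simp [hl])
    refine this.of_eq rfl (by simp) ?_
    funext x
    simp only [Function.update_apply]
    split_ifs <;> simp_all
  | cons a l ih =>
    have h1 := ih (Function.update (Function.update s i l) j (a :: s j)) (by simp [hij])
    have h2 := RunLE.push j a (Function.update s i l)
    rw [Function.update_of_ne hij.symm] at h2
    have h3 := RunLE.loop_step (p := fun _ => true) (f := fun a => .push j a) hl rfl h2 h1
    refine h3.of_eq rfl (by simp; omega) ?_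
    funext x
    simp only [Function.update_apply]
    split_ifs <;> simp_all

theorem RunLE.clear (i : ℕ) (s : Store) :
    RunLE (.loop i (fun _ => true) fun _ => .nop) s ((s i).length * 2 + 1)
      (Function.update s i []) := by
  generalize hl : s i = l
  induction l generalizing s with
  | nil =>
    have := RunLE.loop_exit (i := i) (p := fun _ => true) (f := fun _ => .nop) (s := s)
      (by simp [hl])
    rwa [hl, List.tail_nil] at this
  | cons a l ih =>
    have h1 := ih (Function.update s i l) (by simp)
    have h3 := RunLE.loop_step (p := fun _ => true) (f := fun a => .nop) hl rfl (RunLE.nop _) h1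
    rw [Function.update_idem] at h3
    exact h3.mono (by simp; omega)

/-- Copy a number from one stack to another one, using the next stack as auxiliary memory. -/
def copy (i d : ℕ) : StackProg :=
  .seq (move i (d + 1)) (drain (d + 1) (.seq (.push i (Γ'.bit true)) (.push d (Γ'.bit true))))

theorem RunLE.copy {i d n : ℕ} (hi : i < d) (s : Store) (hs : s i = un n) (hd : s d = [])
    (hd' : s (d + 1) = []) : RunLE (copy i d) s (5 * n + 2) (Function.update s d (un n)) := by
  have h1 := RunLE.move (i := i) (j := d + 1) (by omega) s
  rw [hs, length_un, reverse_un, hd', List.append_nil] at h1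
  have h2 := RunLE.drain (i := d + 1) (n := n) (T := 2)
    (c := .seq (.push i (Γ'.bit true)) (.push d (Γ'.bit true)))
    (fun j => Function.update (Function.update (Function.update s i (un j)) d (un j)) (d + 1)
      (un (n - j))) (by simp) (by
      intro j hj
      refine ((RunLE.push i (Γ'.bit true) _).seq (RunLE.push d (Γ'.bit true) _)).of_eq rfl le_rfl ?_
      funext x
      simp only [Function.update_apply]
      split_ifs <;> first | omega | simp_all [un_succ])
  refine (h1.seq (h2.of_eq ?_ le_rfl ?_)).mono (by omega)
  · funext x
    simp only [Function.update_apply]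
    split_ifs <;> first | omega | simp_all [un_zero]
  · funext x
    simp only [Function.update_apply]
    split_ifs <;> first | omega | simp_all [un_zero]

open Polynomial (X)

/-! ### Functions that can be computed in polynomial time from numbers in unary -/

/-- The stacks hold the bits `x` on the stack `0`, and the number `e j` in unary on the stack `ρ j`; the stacks
`1` and `d, d + 1, …` are free. -/
structure Holds (s : Store) (x : List Bool) (e ρ : ℕ → ℕ) (d : ℕ) : Prop where
  bits : s 0 = x.map Γ'.bit
  scratch : s 1 = []
  num : ∀ j, s (ρ j) = un (e j)
  free : ∀ j, d ≤ j → s j = []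
  low : ∀ j, 3 ≤ ρ j
  lt : ∀ j, ρ j < d

theorem Holds.three_lt {s x e ρ d} (h : Holds s x e ρ d) : 3 < d := (h.low 0).trans_lt (h.lt 0)

/-- All numbers are at most `B`. -/
structure Bdd (x : List Bool) (e : ℕ → ℕ) (B : ℕ) : Prop where
  bits : x.length ≤ B
  num : ∀ j, e j ≤ B

theorem Bdd.mono {x e B B'} (h : Bdd x e B) (hB : B ≤ B') : Bdd x e B' :=
  ⟨h.bits.trans hB, fun j => (h.num j).trans hB⟩

/-- Prepend a number to a sequence. -/
def cons (a : ℕ) (e : ℕ → ℕ) : ℕ → ℕ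
  | 0 => a
  | j + 1 => e j

theorem Bdd.cons {x e B a} (h : Bdd x e B) (ha : a ≤ B) : Bdd x (cons a e) B :=
  ⟨h.bits, fun j => match j with
    | 0 => ha
    | j + 1 => h.num j⟩

/-- A function is polynomially bounded, as long as it depends on bits and numbers. -/
def PolyBdd (f : List Bool → (ℕ → ℕ) → ℕ) : Prop :=
  ∃ p : Polynomial ℕ, ∀ x e B, Bdd x e B → f x e ≤ p.eval B

/-- The function `f` of bits and numbers has polynomially bounded values, and it can be computed in
polynomial time, all numbers being given in unary. -/
def PolyFun (f : List Bool → (ℕ → ℕ) → ℕ) : Prop :=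
  -- The polynomial comes before the assignment of stacks, so relocating data is free; the program
  -- may depend on the assignment, but not on the data.
  PolyBdd f ∧ ∃ p : Polynomial ℕ, ∀ ρ d, ∃ c, ∀ x e B s,
    Bdd x e B → Holds s x e ρ d → RunLE c s (p.eval B) (Function.update s d (un (f x e)))

theorem PolyFun.var (i : ℕ) : PolyFun fun _ e => e i := by
  refine ⟨⟨X, fun x e B h => by simpa using h.num i⟩, 5 * X + 2, fun ρ d => ⟨copy (ρ i) d, ?_⟩⟩
  intro x e B s hB hs
  refine (RunLE.copy (hs.lt i) s (hs.num i) (hs.free d le_rfl) (hs.free _ (by omega))).mono ?_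
  simpa using hB.num i

theorem PolyFun.zero : PolyFun fun _ _ => 0 := by
  refine ⟨⟨0, fun x e B h => by simp⟩, 1, fun ρ d => ⟨.nop, ?_⟩⟩
  intro x e B s hB hs
  refine (RunLE.nop s).of_eq rfl (by simp) ?_
  rw [un_zero, ← hs.free d le_rfl, Function.update_eq_self]

theorem PolyFun.succ {f} (hf : PolyFun f) : PolyFun fun x e => f x e + 1 := by
  obtain ⟨⟨q, hq⟩, p, hp⟩ := hf
  refine ⟨⟨q + 1, fun x e B h => by simpa using hq x e B h⟩, p + 1, fun ρ d => ?_⟩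
  obtain ⟨c, hc⟩ := hp ρ d
  refine ⟨.seq c (.push d (Γ'.bit true)), fun x e B s hB hs => ?_⟩
  refine ((hc x e B s hB hs).seq (RunLE.push d (Γ'.bit true) _)).of_eq rfl (by simp) ?_
  simp [un_succ]

theorem PolyFun.pred {f} (hf : PolyFun f) : PolyFun fun x e => f x e - 1 := by
  obtain ⟨⟨q, hq⟩, p, hp⟩ := hf
  refine ⟨⟨q, fun x e B h => (Nat.sub_le _ _).trans (hq x e B h)⟩, p + 2, fun ρ d => ?_⟩
  obtain ⟨c, hc⟩ := hp ρ d
  refine ⟨.seq c (.case d fun _ => .nop), fun x e B s hB hs => ?_⟩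
  refine ((hc x e B s hB hs).seq (RunLE.case (RunLE.nop _))).of_eq rfl (by simp) ?_
  simp [un]

/-- The bound on all intermediate values is needed because iterating a polynomially bounded step can
produce exponential values. Stack `d` holds the accumulator, `d + 1` the remaining rounds, `d + 2`
the index and `d + 3` the new value. -/
theorem PolyFun.iter {a g : List Bool → (ℕ → ℕ) → ℕ} {h : List Bool → (ℕ → ℕ) → ℕ → ℕ → ℕ}
    (ha : PolyFun a) (hg : PolyFun g) (hh : PolyFun fun x e => h x (fun j => e (j + 2)) (e 0) (e 1))
    (hb : ∃ p : Polynomial ℕ, ∀ x e B, Bdd x e B → ∀ i ≤ g x e,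
      Nat.rec (motive := fun _ => ℕ) (a x e) (h x e) i ≤ p.eval B) :
    PolyFun fun x e => Nat.rec (motive := fun _ => ℕ) (a x e) (h x e) (g x e) := by
  obtain ⟨-, pa, ha⟩ := ha
  obtain ⟨⟨qg, hqg⟩, pg, hg⟩ := hg
  obtain ⟨-, ph, hh⟩ := hh
  obtain ⟨pb, hb⟩ := hb
  refine ⟨⟨pb, fun x e B h => hb x e B h _ le_rfl⟩,
    pa + pg + (qg * (ph.comp (X + qg + pb) + (2 * pb + 1 + (2 * pb + 1 + 1)) + 1) + 1) +
      (2 * qg + 1), fun ρ d => ?_⟩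
  obtain ⟨ca, hca⟩ := ha ρ d
  obtain ⟨cg, hcg⟩ := hg ρ (d + 1)
  -- For the step, variable 0 is the index and variable 1 the accumulator; the old variables move up
  -- by two.
  obtain ⟨ch, hch⟩ := hh (cons (d + 2) (cons d ρ)) (d + 3)
  refine ⟨.seq (.seq (.seq ca cg) (drain (d + 1) (.seq ch (.seq (.loop d (fun _ => true) fun _ => .nop)
    (.seq (move (d + 3) d) (.push (d + 2) (Γ'.bit true)))))))
    (.loop (d + 2) (fun _ => true) fun _ => .nop), fun x e B s hB hs => ?_⟩
  set F : ℕ → ℕ := fun i => Nat.rec (motive := fun _ => ℕ) (a x e) (h x e) i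
  have hF0 : F 0 = a x e := rfl
  have hFg : F (g x e) = Nat.rec (motive := fun _ => ℕ) (a x e) (h x e) (g x e) := rfl
  have hd := hs.three_lt
  have h1 := hca x e B s hB hs
  have h2 := hcg x e B (Function.update s d (un (a x e))) hB
    { bits := by rw [Function.update_of_ne (by omega), hs.bits]
      scratch := by rw [Function.update_of_ne (by omega), hs.scratch]
      num := fun j => by rw [Function.update_of_ne (by have := hs.lt j; omega), hs.num]
      free := fun j hj => by rw [Function.update_of_ne (by omega), hs.free j (by omega)]
      low := hs.low
      lt := fun j => by have := hs.lt j; omega }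
  have h3 := RunLE.drain (i := d + 1) (n := g x e)
    (T := ph.eval (B + qg.eval B + pb.eval B) +
      (2 * pb.eval B + 1 + (2 * pb.eval B + 1 + 1)))
    (c := .seq ch (.seq (.loop d (fun _ => true) fun _ => .nop)
      (.seq (move (d + 3) d) (.push (d + 2) (Γ'.bit true)))))
    (fun j => Function.update (Function.update (Function.update s d (un (F j))) (d + 2) (un j)) (d + 1)
      (un (g x e - j))) (by simp) (by
      intro j hj
      have hFj : F j ≤ pb.eval B := hb x e B hB j hj.le
      have hFj' : F (j + 1) ≤ pb.eval B := hb x e B hB (j + 1) hj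
      have hgB := hqg x e B hB
      have k1 := hch x (cons j (cons (F j) e)) (B + qg.eval B + pb.eval B)
        (Function.update (Function.update (Function.update
          (Function.update s d (un (F j))) (d + 2) (un j)) (d + 1)
          (un (g x e - j))) (d + 1) (un (g x e - (j + 1))))
        (((hB.mono (by omega)).cons (hFj.trans (by omega))).cons (by omega))
        { bits := by
            iterate 4 rw [Function.update_of_ne (by omega)]
            exact hs.bits
          scratch := by
            iterate 4 rw [Function.update_of_ne (by omega)]
            exact hs.scratch
          num := fun i => match i with
            | 0 => by simp [cons]
            | 1 => by simp [cons]
            | i + 2 => by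
              have := hs.lt i
              simp only [Function.update_apply, cons]
              split_ifs <;> first | omega | exact hs.num i
          free := fun i hi => by
            simp only [Function.update_apply]
            split_ifs <;> first | omega | exact hs.free i (by omega)
          low := fun i => match i with
            | 0 => by simp only [cons]; omega
            | 1 => by simp only [cons]; omega
            | i + 2 => hs.low i
          lt := fun i => match i with
            | 0 => by simp only [cons]; omega
            | 1 => by simp only [cons]; omega
            | i + 2 => by have := hs.lt i; simp only [cons]; omega }
      have k2 := RunLE.clear d (Function.update (Function.update (Function.update (Function.update
          (Function.update s d (un (F j))) (d + 2) (un j)) (d + 1)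
          (un (g x e - j))) (d + 1) (un (g x e - (j + 1)))) (d + 3) (un (F (j + 1))))
      have k3 := RunLE.move (i := d + 3) (j := d) (by omega)
        (Function.update (Function.update (Function.update (Function.update (Function.update
          (Function.update s d (un (F j))) (d + 2) (un j)) (d + 1)
          (un (g x e - j))) (d + 1) (un (g x e - (j + 1)))) (d + 3) (un (F (j + 1)))) d [])
      have k4 := RunLE.push (d + 2) (Γ'.bit true) (Function.update (Function.update (Function.update
        (Function.update (Function.update (Function.update (Function.update
          (Function.update s d (un (F j))) (d + 2) (un j)) (d + 1)
          (un (g x e - j))) (d + 1) (un (g x e - (j + 1)))) (d + 3) (un (F (j + 1)))) d [])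
          (d + 3) []) d (un (F (j + 1))))
      refine (k1.seq ((k2.mono ?_).seq ((k3.of_eq rfl ?_ ?_).seq k4))).of_eq rfl le_rfl ?_
      · iterate 4 rw [Function.update_of_ne (by omega)]
        rw [Function.update_self, length_un]
        omega
      · rw [Function.update_of_ne (by omega), Function.update_self, length_un]
        omega
      · simp [reverse_un]
      · funext i
        simp only [Function.update_apply]
        have := hs.free (d + 3) (by omega)
        split_ifs <;> first | omega | simp_all [un_succ])
  have h4 := RunLE.clear (d + 2) (Function.update (Function.update (Function.update s d (un (F (g x e))))
    (d + 2) (un (g x e))) (d + 1) (un (g x e - g x e)))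
  refine (((h1.seq h2).seq (h3.of_eq ?_ (?_ : _ ≤ (qg.eval B) *
    (ph.eval (B + qg.eval B + pb.eval B) +
      (2 * pb.eval B + 1 + (2 * pb.eval B + 1 + 1)) + 1) + 1) ?_)).seq
      (h4.mono (?_ : _ ≤ 2 * qg.eval B + 1))).of_eq rfl ?_ ?_
  · funext i
    simp only [Function.update_apply]
    have := hs.free (d + 2) (by omega)
    split_ifs <;> first | omega | simp_all [un_zero]
  · gcongr
    exact hqg x e B hB
  · rfl
  · have := hqg x e B hB
    rw [Function.update_of_ne (by omega), Function.update_self, length_un]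
    omega
  · simp
  · funext i
    simp only [Function.update_apply]
    have := hs.free (d + 1) (by omega)
    have := hs.free (d + 2) (by omega)
    split_ifs <;> first | omega | simp_all [un_zero]

/-- Read the bit whose index is given by the number `d`, and add it to the number `d'`. -/
def readBit (d' d : ℕ) : StackProg :=
  .seq (.seq (drain d (.case 0 fun o => match o with
    | none => .nop
    | some a => .push 1 a))
    (.case 0 fun o => match o with
    | none => .nop
    | some a => .seq (.push 0 a) (match a with
      | Γ'.bit true => .push d' (Γ'.bit true)
      | _ => .nop))) (move 1 0)

theorem RunLE.readBit {d' d n : ℕ} (hd' : 1 < d') (hd : 1 < d) (hdd : d ≠ d') (s : Store)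
    (x : List Bool) (hs : s 0 = x.map Γ'.bit) (h1 : s 1 = []) (hn : s d = un n) (h0 : s d' = []) :
    RunLE (readBit d' d) s (5 * n + 6)
      (Function.update (Function.update s d []) d' (un (x.getD n false).toNat)) := by
  have k1 := RunLE.drain (i := d) (n := n) (T := 2) (c := .case 0 fun o => match o with
    | none => .nop
    | some a => .push 1 a)
    (fun j => Function.update (Function.update (Function.update s d (un (n - j))) 0
      ((x.drop j).map Γ'.bit)) 1 ((x.take j).map Γ'.bit).reverse)
    (fun j hj => by
      rw [Function.update_of_ne (by omega), Function.update_of_ne (by omega), Function.update_self])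
    (by
      intro j hj
      apply RunLE.case
      rw [Function.update_of_ne (by omega), Function.update_of_ne (by omega), Function.update_self]
      by_cases hx : j < x.length
      · rw [List.drop_eq_getElem_cons hx]
        refine (RunLE.push _ _ _).of_eq rfl le_rfl ?_
        have ht : ((x.take (j + 1)).map Γ'.bit).reverse =
            Γ'.bit x[j] :: ((x.take j).map Γ'.bit).reverse := by
          rw [List.take_succ_eq_append_getElem hx, List.map_append, List.reverse_append]
          rfl
        rw [ht]
        funext i
        simp only [Function.update_apply]
        split_ifs <;> first | omega | simp_all
      · rw [List.drop_eq_nil_of_le (by omega)]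
        refine (RunLE.nop _).of_eq rfl le_rfl ?_
        rw [List.take_of_length_le (by omega), List.take_of_length_le (by omega),
          List.drop_eq_nil_of_le (by omega)]
        funext i
        simp only [Function.update_apply]
        split_ifs <;> first | omega | simp_all)
  have k3 := RunLE.move (i := 1) (j := 0) (by omega) (Function.update (Function.update
    (Function.update (Function.update s d []) 0 ((x.drop n).map Γ'.bit)) 1
      ((x.take n).map Γ'.bit).reverse) d' (un (x.getD n false).toNat))
  have k2 : RunLE (.case 0 fun o => match o with
    | none => .nop
    | some a => .seq (.push 0 a) (match a with
      | Γ'.bit true => .push d' (Γ'.bit true)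
      | _ => .nop)) (Function.update (Function.update (Function.update s d (un (n - n))) 0
      ((x.drop n).map Γ'.bit)) 1 ((x.take n).map Γ'.bit).reverse) 3 (Function.update (Function.update
    (Function.update (Function.update s d []) 0 ((x.drop n).map Γ'.bit)) 1
      ((x.take n).map Γ'.bit).reverse) d' (un (x.getD n false).toNat)) := by
    apply RunLE.case
    rw [Function.update_of_ne (by omega), Function.update_self]
    by_cases hx : n < x.length
    · rw [List.drop_eq_getElem_cons hx, List.getD_eq_getElem _ _ hx]
      cases hb : x[n] with
      | false =>
        refine ((RunLE.push _ _ _).seq (RunLE.nop _)).of_eq rfl (by simp) ?_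
        funext i
        simp only [Function.update_apply]
        split_ifs <;> first | omega | simp_all [un]
      | true =>
        refine ((RunLE.push _ _ _).seq (RunLE.push _ _ _)).of_eq rfl (by simp) ?_
        funext i
        simp only [Function.update_apply]
        split_ifs <;> first | omega | simp_all [un]
    -- An index past the end finds stack `0` empty and adds nothing, in agreement with the default
    -- value `false`.
    · rw [List.drop_eq_nil_of_le (by omega)]
      refine (RunLE.nop _).of_eq rfl (by simp) ?_
      rw [List.getD_eq_default _ _ (by omega)]
      funext i
      simp only [Function.update_apply]
      split_ifs <;> first | omega | simp_all [un]
  refine ((k1.seq k2).seq k3).of_eq ?_ ?_ ?_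
  · funext i
    simp only [Function.update_apply]
    split_ifs <;> first | omega | simp_all
  · rw [Function.update_of_ne (by omega), Function.update_self]
    simp only [List.length_reverse, List.length_map, List.length_take]
    omega
  · have : (x.take n).map Γ'.bit ++ (x.drop n).map Γ'.bit = x.map Γ'.bit := by
      rw [← List.map_append, List.take_append_drop]
    funext i
    simp only [Function.update_apply]
    split_ifs <;> first | omega | simp_all

theorem PolyFun.bit {g} (hg : PolyFun g) : PolyFun fun x e => (x.getD (g x e) false).toNat := by
  obtain ⟨⟨q, hq⟩, p, hp⟩ := hg
  refine ⟨⟨1, fun x e B h => by simpa using Bool.toNat_le _⟩, p + (5 * q + 6), fun ρ d => ?_⟩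
  obtain ⟨c, hc⟩ := hp ρ (d + 1)
  refine ⟨.seq c (readBit d (d + 1)), fun x e B s hB hs => ?_⟩
  have hd := hs.three_lt
  have h1 := hc x e B s hB
    { hs with
      free := fun j hj => hs.free j (by omega)
      lt := fun j => by have := hs.lt j; omega }
  have h2 := RunLE.readBit (d' := d) (d := d + 1) (n := g x e) (by omega) (by omega) (by omega)
    (Function.update s (d + 1) (un (g x e))) x (by rw [Function.update_of_ne (by omega), hs.bits])
    (by rw [Function.update_of_ne (by omega), hs.scratch]) (by simp)
    (by rw [Function.update_of_ne (by omega), hs.free _ le_rfl])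
  refine (h1.seq h2).of_eq rfl ?_ ?_
  · have := hq x e B hB
    simp
    omega
  · rw [Function.update_idem, ← hs.free (d + 1) (by omega), Function.update_eq_self]

/-! ### Closure properties -/

theorem PolyFun.congr {f g} (hf : PolyFun f) (h : ∀ x e, g x e = f x e) : PolyFun g := by
  obtain rfl : g = f := funext fun x => funext fun e => h x e
  exact hf

/-- A change of variables only changes the stacks from which they are read, so it costs no time. -/
theorem PolyFun.rename {f} (hf : PolyFun f) (τ : ℕ → ℕ) : PolyFun fun x e => f x fun j => e (τ j) := by
  obtain ⟨⟨q, hq⟩, p, hp⟩ := hf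
  refine ⟨⟨q, fun x e B h => hq x _ B ⟨h.bits, fun j => h.num _⟩⟩, p, fun ρ d => ?_⟩
  obtain ⟨c, hc⟩ := hp (fun j => ρ (τ j)) d
  exact ⟨c, fun x e B s hB hs => hc x _ B s ⟨hB.bits, fun j => hB.num _⟩
    { hs with
      num := fun j => hs.num _
      low := fun j => hs.low _
      lt := fun j => hs.lt _ }⟩

theorem PolyFun.const (n : ℕ) : PolyFun fun _ _ => n := by
  induction n with
  | zero => exact .zero
  | succ n ih => exact ih.succ

/-- Composition is a recursion with a single round: it starts from `g`, and the step applies `f` to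
the accumulator. -/
theorem PolyFun.let {f : List Bool → (ℕ → ℕ) → ℕ → ℕ} {g} (hg : PolyFun g)
    (hf : PolyFun fun x e => f x (fun j => e (j + 1)) (e 0)) : PolyFun fun x e => f x e (g x e) := by
  have h1 : PolyFun fun x e => f x (fun j => e (j + 2)) (e 1) :=
    (hf.rename fun j => j + 1)
  refine (PolyFun.iter (a := g) (g := fun _ _ => 1) (h := fun x e _ F => f x e F) hg (.const 1)
    h1 ?_).congr fun x e => rfl
  obtain ⟨⟨pg, hg⟩, -⟩ := hg
  obtain ⟨⟨pf, hf⟩, -⟩ := hf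
  refine ⟨pg + pf.comp (X + pg), fun x e B hB i hi => ?_⟩
  simp only [Polynomial.eval_add, Polynomial.eval_comp, Polynomial.eval_X]
  have h2 := hg x e B hB
  obtain rfl | rfl : i = 0 ∨ i = 1 := by omega
  · exact h2.trans (Nat.le_add_right _ _)
  · exact (hf x (cons (g x e) e) _ ((hB.mono (Nat.le_add_right _ _)).cons (by omega))).trans
      (Nat.le_add_left _ _)

theorem PolyFun.comp₂ {f : ℕ → ℕ → ℕ} (hf : PolyFun fun _ e => f (e 0) (e 1)) {g h} (hg : PolyFun g)
    (hh : PolyFun h) : PolyFun fun x e => f (g x e) (h x e) :=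
  PolyFun.let (f := fun x e a => f a (h x e)) hg <|
    PolyFun.let (f := fun _ e b => f (e 0) b) (hh.rename (· + 1)) <|
      hf.rename fun j => match j with
        | 0 => 1
        | _ => 0

theorem PolyFun.add {f g} (hf : PolyFun f) (hg : PolyFun g) : PolyFun fun x e => f x e + g x e := by
  have key : ∀ a n : ℕ, Nat.rec (motive := fun _ => ℕ) a (fun _ F => F + 1) n = a + n :=
    fun a n => by induction n with
      | zero => rfl
      | succ n ih => exact congrArg Nat.succ ih
  refine PolyFun.comp₂ (f := fun a b => a + b) ((PolyFun.iter (a := fun _ e => e 0)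
    (g := fun _ e => e 1) (h := fun _ _ _ F => F + 1) (.var 0) (.var 1) (PolyFun.var 1).succ
    ⟨X + X, fun x e B hB i hi => ?_⟩).congr fun x e => (key _ _).symm) hf hg
  have := hB.num 0
  have := hB.num 1
  simp only [Polynomial.eval_add, Polynomial.eval_X, key]
  omega

theorem PolyFun.sub {f g} (hf : PolyFun f) (hg : PolyFun g) : PolyFun fun x e => f x e - g x e := by
  have key : ∀ a n : ℕ, Nat.rec (motive := fun _ => ℕ) a (fun _ F => F - 1) n = a - n :=
    fun a n => by induction n with
      | zero => rfl
      | succ n ih => exact (congrArg Nat.pred ih).trans rfl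
  refine PolyFun.comp₂ (f := fun a b => a - b) ((PolyFun.iter (a := fun _ e => e 0)
    (g := fun _ e => e 1) (h := fun _ _ _ F => F - 1) (.var 0) (.var 1) (PolyFun.var 1).pred
    ⟨X, fun x e B hB i hi => ?_⟩).congr fun x e => (key _ _).symm) hf hg
  have := hB.num 0
  simp only [Polynomial.eval_X, key]
  omega

/-- Polynomially many polynomially bounded terms keep the partial sums polynomial. Products,
counting, bounded quantifiers, division and divisibility are all derived from this. -/
theorem PolyFun.sum {g : List Bool → (ℕ → ℕ) → ℕ} {h : List Bool → (ℕ → ℕ) → ℕ → ℕ}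
    (hg : PolyFun g) (hh : PolyFun fun x e => h x (fun j => e (j + 1)) (e 0)) :
    PolyFun fun x e => ∑ i ∈ Finset.range (g x e), h x e i := by
  have key : ∀ x e n, Nat.rec (motive := fun _ => ℕ) 0 (fun i F => F + h x e i) n =
      ∑ i ∈ Finset.range n, h x e i := fun x e n => by
    induction n with
      | zero => rfl
      | succ n ih => exact (congrArg (· + h x e n) ih).trans (Finset.sum_range_succ _ _).symm
  refine (PolyFun.iter (a := fun _ _ => 0) (g := g) (h := fun x e i F => F + h x e i) .zero hg
    ((PolyFun.var 1).add (hh.rename fun j => match j with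
      | 0 => 0
      | j + 1 => j + 2)) ?_).congr fun x e => (key _ _ _).symm
  obtain ⟨⟨pg, hg⟩, -⟩ := hg
  obtain ⟨⟨ph, hh⟩, -⟩ := hh
  refine ⟨pg * ph.comp (X + pg), fun x e B hB i hi => ?_⟩
  simp only [Polynomial.eval_mul, Polynomial.eval_comp, Polynomial.eval_add, Polynomial.eval_X, key]
  have hgB := hg x e B hB
  refine (Finset.sum_le_card_nsmul _ _ (ph.eval (B + pg.eval B)) fun j hj => ?_).trans ?_
  · rw [Finset.mem_range] at hj
    exact hh x (cons j e) _ ((hB.mono (Nat.le_add_right _ _)).cons (by omega))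
  · rw [Finset.card_range, smul_eq_mul]
    exact Nat.mul_le_mul_right _ (hi.trans hgB)

theorem PolyFun.mul {f g} (hf : PolyFun f) (hg : PolyFun g) : PolyFun fun x e => f x e * g x e :=
  (PolyFun.sum (g := f) (h := fun x e _ => g x e) hf (hg.rename (· + 1))).congr fun x e => by simp

/-- A predicate that can be decided in polynomial time, all numbers being given in unary. -/
def PolyPred (P : List Bool → (ℕ → ℕ) → Prop) : Prop :=
  ∃ f, PolyFun f ∧ ∀ x e, f x e ≤ 1 ∧ (f x e = 1 ↔ P x e)

theorem PolyPred.congr {P Q} (hP : PolyPred P) (h : ∀ x e, Q x e ↔ P x e) : PolyPred Q := by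
  obtain ⟨f, hf, hP⟩ := hP
  exact ⟨f, hf, fun x e => ⟨(hP x e).1, (hP x e).2.trans (h x e).symm⟩⟩

theorem PolyPred.not {P} (hP : PolyPred P) : PolyPred fun x e => ¬P x e := by
  obtain ⟨f, hf, hP⟩ := hP
  refine ⟨_, (PolyFun.const 1).sub hf, fun x e => ?_⟩
  change _ ∧ (_ ↔ ¬P x e)
  rw [← (hP x e).2]
  have := (hP x e).1
  omega

theorem PolyPred.and {P Q} (hP : PolyPred P) (hQ : PolyPred Q) : PolyPred fun x e => P x e ∧ Q x e := by
  obtain ⟨f, hf, hP⟩ := hP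
  obtain ⟨g, hg, hQ⟩ := hQ
  refine ⟨_, hf.mul hg, fun x e => ?_⟩
  change _ ∧ (_ ↔ P x e ∧ Q x e)
  rw [← (hP x e).2, ← (hQ x e).2, mul_eq_one]
  exact ⟨Nat.mul_le_mul (hP x e).1 (hQ x e).1, Iff.rfl⟩

theorem PolyPred.or {P Q} (hP : PolyPred P) (hQ : PolyPred Q) : PolyPred fun x e => P x e ∨ Q x e :=
  (hP.not.and hQ.not).not.congr fun x e => by tauto

theorem PolyPred.le {f g} (hf : PolyFun f) (hg : PolyFun g) : PolyPred fun x e => f x e ≤ g x e := by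
  refine ⟨_, (PolyFun.const 1).sub (hf.sub hg), fun x e => ?_⟩
  omega

theorem PolyPred.lt {f g} (hf : PolyFun f) (hg : PolyFun g) : PolyPred fun x e => f x e < g x e :=
  PolyPred.le hf.succ hg

theorem PolyPred.eq {f g} (hf : PolyFun f) (hg : PolyFun g) : PolyPred fun x e => f x e = g x e :=
  ((PolyPred.le hf hg).and (PolyPred.le hg hf)).congr fun _ _ => le_antisymm_iff

theorem PolyPred.bit {g} (hg : PolyFun g) : PolyPred fun x e => x.getD (g x e) false = true :=
  ⟨_, hg.bit, fun _ _ => ⟨Bool.toNat_le _, Bool.toNat_eq_one⟩⟩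

open Classical in
theorem PolyFun.ite {P f g} (hP : PolyPred P) (hf : PolyFun f) (hg : PolyFun g) :
    PolyFun fun x e => if P x e then f x e else g x e := by
  obtain ⟨h, hh, hP⟩ := hP
  refine ((hh.mul hf).add (((PolyFun.const 1).sub hh).mul hg)).congr fun x e => ?_
  have h1 := hP x e
  split_ifs with h2
  · rw [h1.2.2 h2]
    simp
  · have : h x e = 0 := by
      have h3 : h x e ≠ 1 := fun h => h2 (h1.2.1 h)
      have h4 : h x e ≤ 1 := h1.1
      omega
    simp [this]

open Classical in
/-- Counting the numbers below a bound that have a property. -/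
theorem PolyFun.card {g : List Bool → (ℕ → ℕ) → ℕ} {P : List Bool → (ℕ → ℕ) → ℕ → Prop}
    (hg : PolyFun g) (hP : PolyPred fun x e => P x (fun j => e (j + 1)) (e 0)) :
    PolyFun fun x e => ((Finset.range (g x e)).filter (P x e)).card :=
  (PolyFun.sum (h := fun x e i => if P x e i then 1 else 0) hg
    (PolyFun.ite hP (.const 1) (.const 0))).congr fun x e => by
      rw [Finset.card_filter]

theorem PolyPred.exists_lt {g : List Bool → (ℕ → ℕ) → ℕ} {P : List Bool → (ℕ → ℕ) → ℕ → Prop}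
    (hg : PolyFun g) (hP : PolyPred fun x e => P x (fun j => e (j + 1)) (e 0)) :
    PolyPred fun x e => ∃ i < g x e, P x e i := by
  classical
  refine (PolyPred.lt .zero (PolyFun.card hg hP)).congr fun x e => ?_
  simp [Finset.card_pos, Finset.Nonempty]

theorem PolyFun.div {f g} (hf : PolyFun f) (hg : PolyFun g) : PolyFun fun x e => f x e / g x e := by
  classical
  refine PolyFun.comp₂ (f := fun a b => a / b) ?_ hf hg
  -- The quotient counts the positive multiples of the divisor up to the dividend; the condition `1
  -- ≤ e 1` yields 0 for division by zero.
  have := PolyFun.card (g := fun _ e => e 0) (P := fun _ e i => (i + 1) * e 1 ≤ e 0 ∧ 1 ≤ e 1) (.var 0)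
    ((PolyPred.le ((PolyFun.var 0).succ.mul (.var 2)) (.var 1)).and (PolyPred.le (.const 1) (.var 2)))
  refine this.congr fun x e => ?_
  generalize e 0 = a
  generalize e 1 = b
  rcases Nat.eq_zero_or_pos b with rfl | hb
  · simp
  · have : (Finset.range a).filter (fun i => (i + 1) * b ≤ a ∧ 1 ≤ b) = Finset.range (a / b) := by
      ext i
      simp only [Finset.mem_filter, Finset.mem_range, ← Nat.le_div_iff_mul_le hb, Nat.succ_le_iff, hb,
        and_true]
      exact ⟨fun h => h.2, fun h => ⟨h.trans_le (Nat.div_le_self _ _), h⟩⟩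
    rw [← Finset.card_range (a / b), ← this]
    congr

theorem PolyFun.mod {f g} (hf : PolyFun f) (hg : PolyFun g) : PolyFun fun x e => f x e % g x e :=
  (hf.sub (hg.mul (hf.div hg))).congr fun x e => by
    have := Nat.mod_add_div (f x e) (g x e)
    omega

theorem PolyPred.dvd {f g} (hf : PolyFun f) (hg : PolyFun g) : PolyPred fun x e => f x e ∣ g x e :=
  (PolyPred.eq (hg.mod hf) .zero).congr fun _ _ => Nat.dvd_iff_mod_eq_zero

/-- Powers of two, cut off at a bound. -/
theorem PolyFun.min_two_pow {f g} (hf : PolyFun f) (hg : PolyFun g) :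
    PolyFun fun x e => min (2 ^ f x e) (g x e) := by
  classical
  -- Doubling with the cap `b` keeps every intermediate value at most `b`, as `PolyFun.iter`
  -- requires.
  have key : ∀ b n : ℕ, Nat.rec (motive := fun _ => ℕ) (if b = 0 then 0 else 1)
      (fun _ F => if F + F ≤ b then F + F else b) n = min (2 ^ n) b := fun b n => by
    induction n with
    | zero =>
      change (if b = 0 then 0 else 1) = min (2 ^ 0) b
      rw [pow_zero]
      split_ifs <;> omega
    | succ n ih =>
      refine (congrArg (fun F => if F + F ≤ b then F + F else b) ih).trans ?_
      simp only [pow_succ]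
      split_ifs <;> omega
  refine PolyFun.comp₂ (f := fun a b => min (2 ^ a) b) ((PolyFun.iter
    (a := fun _ e => if e 1 = 0 then 0 else 1) (g := fun _ e => e 0)
    (h := fun _ e _ F => if F + F ≤ e 1 then F + F else e 1)
    ((PolyFun.ite (PolyPred.eq (.var 1) .zero) .zero (.const 1)).congr fun _ _ => by congr) (.var 0)
    ((PolyFun.ite (PolyPred.le ((PolyFun.var 1).add (.var 1)) (.var 3))
      ((PolyFun.var 1).add (.var 1)) (.var 3)).congr fun _ _ => ?_) ?_).congr
      fun x e => (key _ _).symm) hf hg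
  · congr
  · refine ⟨X, fun x e B hB i hi => ?_⟩
    simp only [key, Polynomial.eval_X]
    exact (min_le_right _ _).trans (hB.num 1)

end StackProg

/-! ### Binary expansions -/

theorem Nat.bits_eq_map_testBit (n : ℕ) : n.bits = (List.range n.size).map n.testBit := by
  refine List.ext_getElem (by simp [Nat.size_eq_bits_len]) fun i h1 h2 => ?_
  rw [List.getElem_map, List.getElem_range, Nat.testBit_eq_inth, List.getI_eq_getElem _ h1]

theorem Computability.encodePosNum_eq_bits (p : PosNum) :
    Computability.encodePosNum p = (p : ℕ).bits := by
  induction p with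
  | one => simp [Computability.encodePosNum]
  | bit0 p ih =>
    have : (p : ℕ) ≠ 0 := (PosNum.cast_pos p).ne'
    rw [Computability.encodePosNum, ih, PosNum.cast_bit0, ← two_mul, Nat.bit0_bits _ this]
  | bit1 p ih =>
    rw [Computability.encodePosNum, ih, PosNum.cast_bit1, ← two_mul, Nat.bit1_bits]

theorem Computability.encodeNat_eq_bits (n : ℕ) : Computability.encodeNat n = n.bits := by
  have h : ∀ m : Num, Computability.encodeNum m = (m : ℕ).bits := fun m => by
    cases m with
    | zero => simp [Computability.encodeNum]
    | pos p => exact Computability.encodePosNum_eq_bits p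
  rw [Computability.encodeNat, h, Num.to_of_nat]

namespace StackProg

open Computability (Γ')
open Polynomial (X)

/-! ### Words that can be written in polynomial time -/

/-- The word `w`, which depends on bits and numbers, can be written in polynomial time to the stack `2`. -/
def Emits (w : List Bool → (ℕ → ℕ) → List Γ') : Prop :=
  (∃ p : Polynomial ℕ, ∀ x e B, Bdd x e B → (w x e).length ≤ p.eval B) ∧
  ∃ p : Polynomial ℕ, ∀ ρ d, ∃ c, ∀ x e B s, Bdd x e B → Holds s x e ρ d →
    RunLE c s (p.eval B) (Function.update s 2 ((w x e).reverse ++ s 2))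

theorem Emits.congr {v w} (hw : Emits w) (h : ∀ x e, v x e = w x e) : Emits v := by
  obtain rfl : v = w := funext fun x => funext fun e => h x e
  exact hw

theorem Emits.letter (a : Γ') : Emits fun _ _ => [a] :=
  ⟨⟨1, fun _ _ _ _ => by simp⟩, 1, fun _ _ => ⟨.push 2 a, fun _ _ _ s _ _ =>
    (RunLE.push 2 a s).of_eq rfl (by simp) rfl⟩⟩

theorem Emits.append {v w} (hv : Emits v) (hw : Emits w) : Emits fun x e => v x e ++ w x e := by
  obtain ⟨⟨qv, hqv⟩, pv, hpv⟩ := hv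
  obtain ⟨⟨qw, hqw⟩, pw, hpw⟩ := hw
  refine ⟨⟨qv + qw, fun x e B h => ?_⟩, pv + pw, fun ρ d => ?_⟩
  · have := hqv x e B h
    have := hqw x e B h
    simp only [List.length_append, Polynomial.eval_add]
    omega
  obtain ⟨cv, hcv⟩ := hpv ρ d
  obtain ⟨cw, hcw⟩ := hpw ρ d
  refine ⟨.seq cv cw, fun x e B s hB hs => ?_⟩
  have hd := hs.three_lt
  refine ((hcv x e B s hB hs).seq (hcw x e B _ hB
    { hs with
      bits := by rw [Function.update_of_ne (by omega), hs.bits]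
      scratch := by rw [Function.update_of_ne (by omega), hs.scratch]
      num := fun j => by rw [Function.update_of_ne (by have := hs.low j; omega), hs.num]
      free := fun j hj => by rw [Function.update_of_ne (by omega), hs.free j hj] })).of_eq rfl
        (by simp) ?_
  simp

open Classical in
theorem Emits.ite {P v w} (hP : PolyPred P) (hv : Emits v) (hw : Emits w) :
    Emits fun x e => if P x e then v x e else w x e := by
  obtain ⟨f, ⟨-, pf, hpf⟩, hP⟩ := hP
  obtain ⟨⟨qv, hqv⟩, pv, hpv⟩ := hv
  obtain ⟨⟨qw, hqw⟩, pw, hpw⟩ := hw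
  refine ⟨⟨qv + qw, fun x e B h => ?_⟩, pf + (pv + pw + 1), fun ρ d => ?_⟩
  · have := hqv x e B h
    have := hqw x e B h
    simp only [Polynomial.eval_add]
    split_ifs <;> omega
  obtain ⟨cf, hcf⟩ := hpf ρ d
  obtain ⟨cv, hcv⟩ := hpv ρ d
  obtain ⟨cw, hcw⟩ := hpw ρ d
  -- The truth value is 0 or 1 in unary, so popping one letter both tests it and frees the stack
  -- again.
  refine ⟨.seq cf (.case d fun o => match o with
    | some _ => cv
    | none => cw), fun x e B s hB hs => ?_⟩
  refine ((hcf x e B s hB hs).seq (RunLE.case (T := pv.eval B + pw.eval B) ?_)).of_eq rfl (by simp) rfl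
  have h2 : Function.update (Function.update s d (un (f x e))) d
      ((Function.update s d (un (f x e)) d)).tail = s := by
    have : (un (f x e)).tail = [] := List.length_eq_zero_iff.1 (by
      rw [List.length_tail, length_un]
      have := (hP x e).1
      omega)
    rw [Function.update_self, Function.update_idem, this, ← hs.free d le_rfl, Function.update_eq_self]
  rw [h2, Function.update_self]
  beta_reduce
  by_cases h : P x e
  · rw [if_pos h, (hP x e).2.2 h]
    exact (hcv x e B s hB hs).mono (by omega)
  · have : f x e = 0 := by
      have h3 : f x e ≠ 1 := fun h' => h ((hP x e).2.1 h')
      have h4 : f x e ≤ 1 := (hP x e).1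
      omega
    rw [if_neg h, this]
    exact (hcw x e B s hB hs).mono (by omega)

open Classical in
theorem Emits.bit {P} (hP : PolyPred P) : Emits fun x e => [Γ'.bit (decide (P x e))] :=
  (Emits.ite hP (.letter (Γ'.bit true)) (.letter (Γ'.bit false))).congr fun x e => by
    split_ifs with h <;> simp [h]

/-- The loop index lives in unary on a stack of its own and becomes variable 0 of the body, hence
the shift of the other variables. -/
theorem Emits.flatMap {g : List Bool → (ℕ → ℕ) → ℕ} {w : List Bool → (ℕ → ℕ) → ℕ → List Γ'}
    (hg : PolyFun g) (hw : Emits fun x e => w x (fun j => e (j + 1)) (e 0)) :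
    Emits fun x e => (List.range (g x e)).flatMap (w x e) := by
  obtain ⟨⟨qg, hqg⟩, pg, hpg⟩ := hg
  obtain ⟨⟨qw, hqw⟩, pw, hpw⟩ := hw
  refine ⟨⟨qg * qw.comp (X + qg), fun x e B hB => ?_⟩,
    pg + (qg * (pw.comp (X + qg) + 1 + 1) + 1) + (2 * qg + 1), fun ρ d => ?_⟩
  · have h1 := hqg x e B hB
    simp only [List.length_flatMap, Polynomial.eval_mul, Polynomial.eval_comp, Polynomial.eval_add,
      Polynomial.eval_X]
    refine (List.sum_le_card_nsmul _ (qw.eval (B + qg.eval B)) ?_).trans ?_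
    · intro m hm
      obtain ⟨j, hj, rfl⟩ := List.mem_map.1 hm
      rw [List.mem_range] at hj
      exact hqw x (cons j e) _ ((hB.mono (Nat.le_add_right _ _)).cons (by omega))
    · rw [List.length_map, List.length_range, smul_eq_mul]
      exact Nat.mul_le_mul_right _ h1
  obtain ⟨cg, hcg⟩ := hpg ρ d
  obtain ⟨cw, hcw⟩ := hpw (cons (d + 1) ρ) (d + 2)
  refine ⟨.seq (.seq cg (drain d (.seq cw (.push (d + 1) (Γ'.bit true)))))
    (.loop (d + 1) (fun _ => true) fun _ => .nop), fun x e B s hB hs => ?_⟩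
  have hd := hs.three_lt
  have h1 := hcg x e B s hB hs
  have h3 := RunLE.drain (i := d) (n := g x e) (T := pw.eval (B + qg.eval B) + 1)
    (c := .seq cw (.push (d + 1) (Γ'.bit true)))
    (fun j => Function.update (Function.update (Function.update s 2
      (((List.range j).flatMap (w x e)).reverse ++ s 2)) (d + 1) (un j)) d (un (g x e - j)))
    (by simp) (by
      intro j hj
      have hgB := hqg x e B hB
      have k1 := hcw x (cons j e) (B + qg.eval B)
        (Function.update (Function.update (Function.update (Function.update s 2
          (((List.range j).flatMap (w x e)).reverse ++ s 2)) (d + 1) (un j)) d (un (g x e - j)))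
            d (un (g x e - (j + 1))))
        ((hB.mono (by omega)).cons (by omega))
        { bits := by
            iterate 4 rw [Function.update_of_ne (by omega)]
            exact hs.bits
          scratch := by
            iterate 4 rw [Function.update_of_ne (by omega)]
            exact hs.scratch
          num := fun i => match i with
            | 0 => by simp [cons]
            | i + 1 => by
              have := hs.lt i
              have := hs.low i
              simp only [Function.update_apply, cons]
              split_ifs <;> first | omega | exact hs.num i
          free := fun i hi => by
            simp only [Function.update_apply]
            split_ifs <;> first | omega | exact hs.free i (by omega)
          low := fun i => match i with
            | 0 => by simp only [cons]; omega
            | i + 1 => hs.low i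
          lt := fun i => match i with
            | 0 => by simp only [cons]; omega
            | i + 1 => by have := hs.lt i; simp only [cons]; omega }
      have k2 : (w x (fun i => cons j e (i + 1)) (cons j e 0)).reverse ++
          ((((List.range j).flatMap (w x e)).reverse ++ s 2)) =
          (((List.range (j + 1)).flatMap (w x e)).reverse ++ s 2) := by
        rw [List.range_succ, List.flatMap_append, List.reverse_append]
        simp [cons]
      rw [Function.update_of_ne (show 2 ≠ d by omega), Function.update_of_ne (show 2 ≠ d by omega),
        Function.update_of_ne (show 2 ≠ d + 1 by omega), Function.update_self, k2] at k1
      refine (k1.seq (RunLE.push (d + 1) (Γ'.bit true) _)).of_eq rfl le_rfl ?_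
      funext i
      simp only [Function.update_apply]
      split_ifs <;> first | omega | simp_all [un_succ])
  have h4 := RunLE.clear (d + 1) (Function.update (Function.update (Function.update s 2
      (((List.range (g x e)).flatMap (w x e)).reverse ++ s 2)) (d + 1) (un (g x e))) d
        (un (g x e - g x e)))
  refine ((h1.seq (h3.of_eq ?_ (?_ : _ ≤ (qg.eval B) * (pw.eval (B + qg.eval B) + 1 + 1) + 1) ?_)).seq
      (h4.mono (?_ : _ ≤ 2 * qg.eval B + 1))).of_eq rfl ?_ ?_
  · funext i
    simp only [Function.update_apply]
    have := hs.free (d + 1) (by omega)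
    split_ifs <;> first | omega | simp_all [un_zero]
  · gcongr
    exact hqg x e B hB
  · rfl
  · have := hqg x e B hB
    rw [Function.update_of_ne (by omega), Function.update_self, length_un]
    omega
  · simp
  · funext i
    simp only [Function.update_apply]
    have := hs.free d (by omega)
    have := hs.free (d + 1) (by omega)
    split_ifs <;> first | omega | simp_all [un_zero]

theorem Emits.unary {g} (hg : PolyFun g) : Emits fun x e => unaryWord (g x e) :=
  ((Emits.flatMap (w := fun _ _ _ => [Γ'.bit true]) hg (.letter _)).append
    (.letter Γ'.comma)).congr fun x e => by
      have : ∀ n, List.replicate n (Γ'.bit true) = (List.range n).flatMap fun _ => [Γ'.bit true] := by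
        intro n
        induction n with
        | zero => rfl
        | succ n ih => rw [List.range_succ, List.flatMap_append, List.replicate_succ', ih]; rfl
      rw [unaryWord, this]

theorem Emits.binary {g} (hg : PolyFun g) : Emits fun x e => binaryWord (g x e) := by
  classical
  -- The number of binary digits is the number of `j` with `2 ^ j ≤ n`; capping the power at `n + 1`
  -- does not affect the comparison.
  have h1 := PolyFun.card (g := g) (P := fun x e j => min (2 ^ j) (g x e + 1) ≤ g x e) hg
    (PolyPred.le (PolyFun.min_two_pow (.var 0) (hg.rename (· + 1)).succ) (hg.rename (· + 1)))
  have h2 := PolyPred.eq ((PolyFun.div (hg.rename (· + 1))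
    (PolyFun.min_two_pow (.var 0) (hg.rename (· + 1)).succ)).mod (.const 2)) (.const 1)
  refine ((Emits.flatMap (w := fun x e j =>
    [Γ'.bit (decide (g x e / min (2 ^ j) (g x e + 1) % 2 = 1))]) h1
      ((Emits.bit h2).congr fun x e => by congr)).append (.letter Γ'.comma)).congr fun x e => ?_
  generalize g x e = n
  have h3 : (Finset.range n).filter (fun j => min (2 ^ j) (n + 1) ≤ n) = Finset.range n.size := by
    ext j
    rw [Finset.mem_filter, Finset.mem_range, Finset.mem_range, Nat.lt_size]
    have := Nat.lt_two_pow_self (n := j)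
    omega
  have h4 : ∀ j, decide (n / min (2 ^ j) (n + 1) % 2 = 1) = n.testBit j := fun j => by
    rw [Nat.testBit_eq_decide_div_mod_eq]
    rcases le_total (2 ^ j) (n + 1) with h | h
    · rw [min_eq_left h]
    · rw [min_eq_right h, Nat.div_eq_of_lt (Nat.lt_succ_self n)]
      rcases h.eq_or_lt with h | h
      · rw [← h, Nat.div_eq_of_lt (Nat.lt_succ_self n)]
      · rw [Nat.div_eq_of_lt (by omega)]
  have h5 : ((Finset.range n).filter (fun j => min (2 ^ j) (n + 1) ≤ n)).card = n.size := by
    rw [h3, Finset.card_range]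
  rw [binaryWord, Computability.encodeNat_eq_bits, Nat.bits_eq_map_testBit, List.map_map,
    List.map_eq_flatMap]
  congr 2
  · funext j
    simp only [Function.comp_apply, h4]
  · convert (congrArg List.range h5).symm

end StackProg

/-! ### From polynomial bounds to a machine with FPT running time -/

theorem Polynomial.eval_le_mul_pow (p : Polynomial ℕ) :
    ∃ C D : ℕ, ∀ B, p.eval B ≤ C * (B + 1) ^ D := by
  refine ⟨p.sum fun _ a => a, p.natDegree, fun B => ?_⟩
  rw [Polynomial.eval_eq_sum, Polynomial.sum, Polynomial.sum, Finset.sum_mul]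
  refine Finset.sum_le_sum fun i hi => Nat.mul_le_mul_left _ ?_
  exact (Nat.pow_le_pow_left (Nat.le_succ B) i).trans
    (Nat.pow_le_pow_right (Nat.succ_pos B) (Polynomial.le_natDegree_of_mem_supp i hi))

namespace StackProg

open Computability (Γ')
open Polynomial (X)

/-- Push the number `n` in unary. -/
def pushUn (i : ℕ) : ℕ → StackProg
  | 0 => .nop
  | n + 1 => .seq (pushUn i n) (.push i (Γ'.bit true))

theorem RunLE.pushUn (i n : ℕ) (s : Store) :
    RunLE (pushUn i n) s (n + 1) (Function.update s i (un n ++ s i)) := by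
  induction n with
  | zero => exact (RunLE.nop s).of_eq rfl le_rfl (by simp [un_zero])
  | succ n ih =>
    refine (ih.seq (RunLE.push i (Γ'.bit true) _)).of_eq rfl le_rfl ?_
    simp [un_succ]

/-- Multiply the number on the stack `i` by `m`, where the stack `j` is free. -/
def scale (i j m : ℕ) : StackProg := .seq (move i j) (drain j (pushUn i m))

theorem RunLE.scale {i j n : ℕ} (m : ℕ) (hij : i ≠ j) (s : Store) (hi : s i = un n)
    (hj : s j = []) :
    RunLE (scale i j m) s ((m + 4) * n + 2) (Function.update s i (un (m * n))) := by
  have h1 := RunLE.move hij s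
  rw [hi, length_un, reverse_un, hj, List.append_nil] at h1
  have h2 := RunLE.drain (i := j) (n := n) (T := m + 1) (c := StackProg.pushUn i m)
    (fun l => Function.update (Function.update s i (un (m * l))) j (un (n - l))) (by simp) (by
      intro l hl
      refine (RunLE.pushUn i m _).of_eq rfl le_rfl ?_
      have : m * (l + 1) = m + m * l := by ring
      funext x
      simp only [Function.update_apply]
      split_ifs <;> first | omega | simp_all [un_append])
  refine (h1.seq (h2.of_eq ?_ le_rfl ?_)).mono (le_of_eq (by ring))
  · funext x
    simp only [Function.update_apply]
    split_ifs <;> first | omega | simp_all [un_zero]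
  · funext x
    simp only [Function.update_apply]
    split_ifs <;> first | omega | simp_all [un_zero]

/-- Tests for a separator. -/
def notComma : Γ' → Bool
  | Γ'.comma => false
  | _ => true

/-- Read two numbers `k` and `n` in unary from the input to the stacks `4` and `5`, and compute
the number `16 ^ (k + 1)` on the stack `6`. -/
def readHeader : StackProg :=
  .seq (.seq (pushUn 6 16) (.loop 0 notComma fun _ => .seq (.push 4 (Γ'.bit true)) (scale 6 7 16)))
    (.loop 0 notComma fun _ => .push 5 (Γ'.bit true))

/-- The numbers which `readHeader` computes. -/
def headerNum (k n : ℕ) : ℕ → ℕ := cons k (cons n (cons (16 ^ (k + 1)) fun _ => 0))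

/-- The stacks of the numbers which `readHeader` computes. -/
def headerReg : ℕ → ℕ := cons 4 (cons 5 (cons 6 fun _ => 3))

/-- The stacks after `readHeader`. -/
def headerStore (k n : ℕ) (x : List Bool) : Store :=
  Function.update (Function.update (Function.update (Function.update (fun _ => []) 4 (un k)) 5 (un n))
    6 (un (16 ^ (k + 1)))) 0 (x.map Γ'.bit)

/-- Each letter of `k` multiplies stack `6` by 16. This is the only place where the dependence on
`k` is exponential; afterwards `16 ^ (k + 1)` is just another unary number. -/
theorem RunLE.readHeader (k n : ℕ) (x : List Bool) :
    RunLE readHeader (Store.single 0 (unaryWord k ++ (unaryWord n ++ x.map Γ'.bit)))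
      (17 + (k * (1 + (20 * 16 ^ (k + 1) + 2) + 1) + 1) + (n * 2 + 1)) (headerStore k n x) := by
  have hw : ∀ m, unaryWord m = un m ++ [Γ'.comma] := fun m => rfl
  have h1 := RunLE.pushUn 6 16 (Store.single 0 (unaryWord k ++ (unaryWord n ++ x.map Γ'.bit)))
  have h2 := RunLE.loop_unary (i := 0) (p := notComma)
    (f := fun _ => .seq (.push 4 (Γ'.bit true)) (StackProg.scale 6 7 16)) (n := k)
    (T := 1 + (20 * 16 ^ (k + 1) + 2)) (l := Γ'.comma :: (unaryWord n ++ x.map Γ'.bit))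
    (fun j => Function.update (Function.update (Function.update (fun _ => []) 4 (un j))
      6 (un (16 ^ (j + 1)))) 0 (un (k - j) ++ Γ'.comma :: (unaryWord n ++ x.map Γ'.bit)))
    (fun j hj => by simp) rfl (by simp [notComma]) (by
      intro j hj
      have k2 := RunLE.scale (i := 6) (j := 7) (n := 16 ^ (j + 1)) 16 (by omega)
        (Function.update (Function.update (Function.update (fun _ => []) 4 (un (j + 1)))
      6 (un (16 ^ (j + 1)))) 0 (un (k - (j + 1)) ++ Γ'.comma :: (unaryWord n ++ x.map Γ'.bit)))
        (by simp) (by simp)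
      refine ((RunLE.push 4 (Γ'.bit true) _).seq (k2.of_eq ?_ ?_ rfl)).of_eq rfl le_rfl ?_
      · funext i
        simp only [Function.update_apply]
        split_ifs <;> first | omega | simp_all [un_succ]
      · have : 16 ^ (j + 1) ≤ 16 ^ (k + 1) := Nat.pow_le_pow_right (by omega) (by omega)
        omega
      · have : 16 ^ (j + 1 + 1) = 16 * 16 ^ (j + 1) := by ring
        rw [this]
        funext i
        simp only [Function.update_apply]
        split_ifs <;> first | omega | simp_all)
  have h3 := RunLE.loop_unary (i := 0) (p := notComma)
    (f := fun _ => .push 5 (Γ'.bit true)) (n := n)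
    (T := 1) (l := Γ'.comma :: x.map Γ'.bit)
    (fun j => Function.update (Function.update (Function.update (Function.update (fun _ => []) 4 (un k))
      5 (un j)) 6 (un (16 ^ (k + 1)))) 0 (un (n - j) ++ Γ'.comma :: x.map Γ'.bit))
    (fun j hj => by simp) rfl (by simp [notComma]) (by
      intro j hj
      refine (RunLE.push 5 (Γ'.bit true) _).of_eq rfl le_rfl ?_
      funext i
      simp only [Function.update_apply]
      split_ifs <;> first | omega | simp_all [un_succ])
  refine ((h1.seq (h2.of_eq ?_ le_rfl rfl)).seq (h3.of_eq ?_ le_rfl ?_)).of_eq rfl le_rfl rfl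
  · funext i
    simp only [Function.update_apply, Store.single, hw]
    split_ifs <;> first | omega | simp_all [un_zero]
  · funext i
    simp only [Function.update_apply, hw]
    split_ifs <;> first | omega | simp_all [un_zero]
  · funext i
    simp only [Function.update_apply, headerStore]
    split_ifs <;> first | omega | simp_all [un_zero]

/-- Stack `3` stays empty and so serves as the number 0 for all variables from index 3 on. Stack
`7`, the auxiliary memory of the header, is free again. -/
theorem holds_headerStore (k n : ℕ) (x : List Bool) :
    Holds (headerStore k n x) x (headerNum k n) headerReg 7 where
  bits := by simp [headerStore]
  scratch := by simp [headerStore]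
  num j := match j with
    | 0 => by simp [headerStore, headerReg, headerNum, cons]
    | 1 => by simp [headerStore, headerReg, headerNum, cons]
    | 2 => by simp [headerStore, headerReg, headerNum, cons]
    | j + 3 => by simp [headerStore, headerReg, headerNum, cons, un_zero]
  free j hj := by
    simp only [headerStore]
    iterate 4 rw [Function.update_of_ne (by omega)]
  low j := match j with
    | 0 => by simp [headerReg, cons]
    | 1 => by simp [headerReg, cons]
    | 2 => by simp [headerReg, cons]
    | j + 3 => by simp [headerReg, cons]
  lt j := match j with
    | 0 => by simp [headerReg, cons]
    | 1 => by simp [headerReg, cons]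
    | 2 => by simp [headerReg, cons]
    | j + 3 => by simp [headerReg, cons]

/-- Empty a stack. -/
def clear (i : ℕ) : StackProg := .loop i (fun _ => true) fun _ => .nop

/-- A word that depends on bits, on two numbers `k` and `n`, and on `16 ^ (k + 1)`, and that can be
written in polynomial time, can be computed from the bits and `k` and `n` in time `h(k) * L ^ c`,
where `L` is the length of the input. -/
theorem Emits.exists_machine {w : List Bool → (ℕ → ℕ) → List Γ'} (hw : Emits w) :
    ∃ (c : StackProg) (h : ℕ → ℕ) (D : ℕ), Computable h ∧ ∀ k n x,
      Nonempty (Turing.TM2OutputsInTime c.toMachine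
        (unaryWord k ++ (unaryWord n ++ x.map Γ'.bit) : List Γ')
        (some (w x (headerNum k n)))
        (h k * (unaryWord k ++ (unaryWord n ++ x.map Γ'.bit)).length ^ D)) := by
  obtain ⟨⟨q, hq⟩, p, hp⟩ := hw
  obtain ⟨c, hc⟩ := hp headerReg 7
  -- The summands pay for the header, the word, the emptying of stacks `0`, `4`, `5`, `6`, the move
  -- of the reversed word to the output stack, and the halting step.
  obtain ⟨C, D, hCD⟩ := Polynomial.eval_le_mul_pow
    (17 + (X * (1 + (20 * X + 2) + 1) + 1) + (X * 2 + 1) + p + (X * 2 + 1) + (X * 2 + 1) + (X * 2 + 1)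
      + (X * 2 + 1) + (q * 2 + 1) + 1)
  refine ⟨.seq (.seq (.seq (.seq (.seq (.seq readHeader c) (clear 0)) (clear 4)) (clear 5)) (clear 6))
    (move 2 1), fun k => C * (16 ^ (k + 1) + 2) ^ D, D, ?_, fun k n x => ?_⟩
  · have hpow : Primrec₂ fun a b : ℕ => a ^ b := Primrec₂.unpaired'.1 Nat.Primrec.pow
    exact (Primrec.nat_mul.comp (.const C) (hpow.comp (Primrec.nat_add.comp
      (hpow.comp (.const 16) Primrec.succ) (.const 2)) (.const D))).to_comp
  · set L := (unaryWord k ++ (unaryWord n ++ x.map Γ'.bit)).length with hL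
    have hL' : L = k + n + x.length + 2 := by
      simp only [hL, unaryWord, List.length_append, List.length_replicate, List.length_map,
        List.length_singleton]
      omega
    have hK : 0 < 16 ^ (k + 1) := by positivity
    have hB : Bdd x (headerNum k n) (16 ^ (k + 1) + L) :=
      ⟨by omega, fun j => match j with
        | 0 => by simp only [headerNum, cons]; omega
        | 1 => by simp only [headerNum, cons]; omega
        | 2 => by simp only [headerNum, cons]; omega
        | j + 3 => by simp only [headerNum, cons]; omega⟩
    have h0 := RunLE.readHeader k n x
    have h1 := hc x _ _ _ hB (holds_headerStore k n x)
    have e2 : headerStore k n x 2 = [] := by simp [headerStore]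
    rw [e2, List.append_nil] at h1
    set s := Function.update (headerStore k n x) 2 (w x (headerNum k n)).reverse with hs
    have h2 := RunLE.clear 0 s
    have h3 := RunLE.clear 4 (Function.update s 0 [])
    have h4 := RunLE.clear 5 (Function.update (Function.update s 0 []) 4 [])
    have h5 := RunLE.clear 6 (Function.update (Function.update (Function.update s 0 []) 4 []) 5 [])
    have h6 := RunLE.move (i := 2) (j := 1) (by omega)
      (Function.update (Function.update (Function.update (Function.update s 0 []) 4 []) 5 []) 6 [])
    obtain ⟨t, ht, hr⟩ := ((((((h0.seq h1).seq h2).seq h3).seq h4).seq h5).seq h6).of_eq rfl le_rfl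
      (show _ = Store.single 1 (w x (headerNum k n)) by
        funext i
        simp only [Function.update_apply, Store.single, hs, headerStore]
        split_ifs <;> first | omega | simp_all)
    refine toMachine_outputs hr ?_
    have hlen := hq x _ _ hB
    have h7 := hCD (16 ^ (k + 1) + L)
    -- This splits a power of `16 ^ (k + 1) + L + 1` into a factor depending on `k` and a power of
    -- the input length.
    have h8 : (16 ^ (k + 1) + L + 1) ^ D ≤ (16 ^ (k + 1) + 2) ^ D * L ^ D := by
      rw [← mul_pow]
      refine Nat.pow_le_pow_left ?_ D
      have : 2 ≤ L := by omega
      nlinarith [Nat.zero_le (16 ^ (k + 1))]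
    refine le_trans ?_ ((h7.trans (Nat.mul_le_mul_left C h8)).trans (le_of_eq (mul_assoc _ _ _).symm))
    have s0 : s 0 = x.map Γ'.bit := by simp [hs, headerStore]
    have s4 : s 4 = un k := by simp [hs, headerStore]
    have s5 : s 5 = un n := by simp [hs, headerStore]
    have s6 : s 6 = un (16 ^ (k + 1)) := by simp [hs, headerStore]
    have s2 : s 2 = (w x (headerNum k n)).reverse := by simp [hs]
    simp [s0, s4, s5, s6, s2, length_un] at ht
    simp only [Polynomial.eval_add, Polynomial.eval_mul, Polynomial.eval_X, Polynomial.eval_one,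
      Polynomial.eval_ofNat]
    have hk : k * (1 + (20 * 16 ^ (k + 1) + 2) + 1) ≤
        (16 ^ (k + 1) + L) * (1 + (20 * (16 ^ (k + 1) + L) + 2) + 1) :=
      Nat.mul_le_mul (by omega) (by omega)
    omega

end StackProg

/-! ### Graphs given by a parent relation -/

/-- The graph on `0, …, N - 1` whose edges are the pairs with the relation `P`, in one of the two orders. -/
def relGraph (N : ℕ) (P : ℕ → ℕ → Prop) : SimpleGraph (Fin N) :=
  SimpleGraph.fromRel fun u v => P u v

/-- Both neighbors of a vertex of maximal rank on a cycle must be its parents. As parents are unique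
the two neighbors coincide, which is impossible on a cycle. -/
theorem relGraph_isAcyclic {N : ℕ} {P : ℕ → ℕ → Prop} (rank : ℕ → ℕ)
    (hP : ∀ u v v', P u v → P u v' → v = v') (hr : ∀ u v, P u v → rank v < rank u) :
    (relGraph N P).IsAcyclic := by
  classical
  intro v c hc
  obtain ⟨x, hx, hmax⟩ := Finset.exists_max_image c.support.toFinset (fun v : Fin N => rank v)
    ⟨v, by simp⟩
  have hx' : x ∈ c.support := by simpa using hx
  have hc' := hc.rotate hx'
  have key : ∀ y : Fin N, y ∈ c.support → (relGraph N P).Adj x y → P x y := by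
    intro y hy hxy
    rcases ((SimpleGraph.fromRel_adj _ _ _).1 hxy).2 with h | h
    · exact h
    · have h1 := hr _ _ h
      have h2 := hmax y (by simpa using hy)
      omega
  have hmem : ∀ y : Fin N, y ∈ (c.rotate x hx').support → y ∈ c.support := by
    intro y hy
    exact (SimpleGraph.Walk.mem_support_rotate_iff c x hx').1 hy
  have h1 := key _ (hmem _ (SimpleGraph.Walk.getVert_mem_support _ 1))
    (SimpleGraph.Walk.adj_snd hc'.not_nil)
  have h2 := key _ (hmem _ (SimpleGraph.Walk.getVert_mem_support _ _))
    (SimpleGraph.Walk.adj_penultimate hc'.not_nil).symm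
  exact hc'.snd_ne_penultimate (Fin.ext (hP _ _ _ h1 h2))

theorem coloringWeight_natCast {V : Type*} [Fintype V] {G : SimpleGraph V} {r : ℕ} (w : V → ℕ)
    (c : G.Coloring (Fin r)) : coloringWeight (fun v => (w v : ℝ≥0)) c =
      ((∑ i : Fin r, (Finset.univ.filter fun v => c v = i).sup w : ℕ) : ℝ≥0) := by
  rw [coloringWeight, Nat.cast_sum]
  refine Finset.sum_congr rfl fun i _ => ?_
  rw [colorWeight, Finset.apply_sup_eq_sup_comp_of_linearOrder (Nat.cast : ℕ → ℝ≥0) Nat.mono_cast]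
  · rfl
  · simp

theorem sigma_natCast_le_iff {V : Type*} [Fintype V] {G : SimpleGraph V} {r M : ℕ} (w : V → ℕ) :
    sigma G (fun v => (w v : ℝ≥0)) r ≤ ((M : ℝ≥0) : ℝ≥0∞) ↔ ∃ c : G.Coloring (Fin r),
      ∑ i : Fin r, (Finset.univ.filter fun v => c v = i).sup w ≤ M := by
  have hfin : Finite (G.Coloring (Fin r)) := Finite.of_injective _ DFunLike.coe_injective
  have hc : ∀ c : G.Coloring (Fin r), (coloringWeight (fun v => (w v : ℝ≥0)) c : ℝ≥0∞) ≤
      ((M : ℝ≥0) : ℝ≥0∞) ↔ ∑ i : Fin r, (Finset.univ.filter fun v => c v = i).sup w ≤ M := by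
    intro c
    rw [coloringWeight_natCast, ENNReal.coe_le_coe, Nat.cast_le]
  simp only [← hc]
  constructor
  · intro h
    cases isEmpty_or_nonempty (G.Coloring (Fin r)) with
    | inl he =>
      rw [sigma, iInf_of_empty] at h
      exact absurd h (by simp)
    | inr hn =>
      obtain ⟨c, hc⟩ := exists_eq_ciInf_of_finite
        (f := fun c : G.Coloring (Fin r) => (coloringWeight (fun v => (w v : ℝ≥0)) c : ℝ≥0∞))
      exact ⟨c, hc.trans_le h⟩
  · rintro ⟨c, h⟩
    exact (iInf_le _ c).trans h

/-- A coloring with at most the weight `M`, its colors being ordered by decreasing weight, yields colors and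
weights of colors as functions on the natural numbers. -/
theorem exists_antitone_of_sigma_le {N r M : ℕ} {P : ℕ → ℕ → Prop} {w : ℕ → ℕ}
    (h : sigma (relGraph N P) (fun v => ((w v : ℕ) : ℝ≥0)) r ≤ ((M : ℝ≥0) : ℝ≥0∞)) :
    ∃ col W : ℕ → ℕ, (∀ u < N, col u < r) ∧ (∀ u < N, w u ≤ W (col u)) ∧
      (∀ u < N, ∀ v < N, u ≠ v → P u v → col u ≠ col v) ∧
      (∀ i j, i ≤ j → j < r → W j ≤ W i) ∧ ∑ j ∈ Finset.range r, W j ≤ M := by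
  obtain ⟨c, hc⟩ := (sigma_natCast_le_iff (fun v : Fin N => w v)).1 h
  set W : Fin r → ℕ := fun i => (Finset.univ.filter fun v => c v = i).sup fun v : Fin N => w v with hW
  -- `Tuple.sort` sorts increasingly; the order dual makes the weights decrease.
  let f : Fin r → ℕᵒᵈ := fun i => OrderDual.toDual (W i)
  let τ := Tuple.sort f
  have hτ : Monotone (f ∘ τ) := Tuple.monotone_sort f
  refine ⟨fun u => if h : u < N then τ.symm (c ⟨u, h⟩) else 0,
    fun j => if h : j < r then W (τ ⟨j, h⟩) else 0, ?_, ?_, ?_, ?_, ?_⟩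
  · intro u hu
    simp [hu]
  · intro u hu
    simp only [hu, dite_true, Fin.is_lt, Fin.eta, Equiv.apply_symm_apply]
    exact Finset.le_sup (f := fun v : Fin N => w v) (b := ⟨u, hu⟩) (by simp)
  · intro u hu v hv huv hP
    simp only [hu, hv, dite_true]
    intro h
    have h1 : c ⟨u, hu⟩ = c ⟨v, hv⟩ := τ.symm.injective (Fin.ext h)
    exact c.valid ((SimpleGraph.fromRel_adj _ _ _).2 ⟨fun h => huv (congrArg Fin.val h), Or.inl hP⟩) h1
  · intro i j hij hj
    simp only [hj, hij.trans_lt hj, dite_true]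
    exact hτ (a := ⟨i, hij.trans_lt hj⟩) (b := ⟨j, hj⟩) hij
  · rw [Finset.sum_range]
    simp only [Fin.is_lt, dite_true, Fin.eta]
    rw [Equiv.sum_comp τ W]
    exact hc

/-- `W` only has to bound the weights in each color class, so no maximum over a class needs to be
computed. -/
theorem sigma_le_of_colors {N r M : ℕ} {P : ℕ → ℕ → Prop} {w : ℕ → ℕ} (col W : ℕ → ℕ)
    (hcol : ∀ u < N, col u < r) (hW : ∀ u < N, w u ≤ W (col u))
    (hP : ∀ u < N, ∀ v < N, P u v → col u ≠ col v) (hM : ∑ j ∈ Finset.range r, W j ≤ M) :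
    sigma (relGraph N P) (fun v => ((w v : ℕ) : ℝ≥0)) r ≤ ((M : ℝ≥0) : ℝ≥0∞) := by
  refine (sigma_natCast_le_iff (fun v : Fin N => w v)).2
    ⟨SimpleGraph.Coloring.mk (fun u => ⟨col u, hcol u u.2⟩) ?_, ?_⟩
  · intro u v huv h
    rcases ((SimpleGraph.fromRel_adj _ _ _).1 huv).2 with h1 | h1
    · exact hP u u.2 v v.2 h1 (congrArg Fin.val h)
    · exact hP v v.2 u u.2 h1 (congrArg Fin.val h).symm
  · rw [Finset.sum_range] at hM
    refine (Finset.sum_le_sum fun i _ => Finset.sup_le fun v hv => ?_).trans hM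
    have : (⟨col v, hcol v v.2⟩ : Fin r) = i := (Finset.mem_filter.1 hv).2
    rw [← this]
    exact hW v v.2

/-! ### Divisibility by powers of two -/

/-- In a binomial tree, `s + 2 ^ i` is the child of `s` with valuation `i`. -/
theorem padicValNat_two_add_pow {i s : ℕ} (h : 2 ^ (i + 1) ∣ s) : padicValNat 2 (s + 2 ^ i) = i := by
  have hpos : 0 < 2 ^ i := by positivity
  have h0 : s + 2 ^ i ≠ 0 := by omega
  have h1 : 2 ^ i ∣ s := (pow_dvd_pow 2 (Nat.le_succ i)).trans h
  have h2 : i ≤ padicValNat 2 (s + 2 ^ i) :=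
    (padicValNat_dvd_iff_le h0).1 (Nat.dvd_add h1 dvd_rfl)
  have h3 : ¬i + 1 ≤ padicValNat 2 (s + 2 ^ i) := fun h4 => by
    have h5 : 2 ^ (i + 1) ∣ 2 ^ i := (Nat.dvd_add_right h).1 ((padicValNat_dvd_iff_le h0).2 h4)
    have := Nat.le_of_dvd hpos h5
    rw [pow_succ] at this
    omega
  omega

theorem add_pow_lt_two_pow {i r s : ℕ} (hi : i < r) (hs : s < 2 ^ r) (h : 2 ^ (i + 1) ∣ s) :
    s + 2 ^ i < 2 ^ r := by
  obtain ⟨m, rfl⟩ := h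
  obtain ⟨l, rfl⟩ : ∃ l, r = i + 1 + l := ⟨r - (i + 1), by omega⟩
  rw [pow_add _ (i + 1) l] at hs ⊢
  have h1 : m < 2 ^ l := lt_of_mul_lt_mul_left hs (Nat.zero_le _)
  have h2 : 2 ^ (i + 1) * (m + 1) ≤ 2 ^ (i + 1) * 2 ^ l := Nat.mul_le_mul_left _ h1
  have h3 : 0 < 2 ^ i := by positivity
  rw [mul_add, pow_succ] at h2
  rw [pow_succ] at *
  omega

theorem padicValNat_two_lt {r s : ℕ} (h0 : s ≠ 0) (hs : s < 2 ^ r) : padicValNat 2 s < r := by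
  have h1 : 2 ^ padicValNat 2 s ≤ s := Nat.le_of_dvd (by omega) pow_padicValNat_dvd
  exact (Nat.pow_lt_pow_iff_right (by omega)).1 (h1.trans_lt hs)

/-- Clearing the lowest one bit raises the valuation: a nonroot parent has a larger valuation than
its child. -/
theorem padicValNat_sub_pow {s : ℕ} (h0 : s ≠ 0) (h : s - 2 ^ padicValNat 2 s ≠ 0) :
    padicValNat 2 s < padicValNat 2 (s - 2 ^ padicValNat 2 s) := by
  refine (padicValNat_dvd_iff_le h).1 ?_
  obtain ⟨m, hm⟩ : 2 ^ padicValNat 2 s ∣ s := pow_padicValNat_dvd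
  have h1 : ¬2 ^ (padicValNat 2 s + 1) ∣ s := pow_succ_padicValNat_not_dvd h0
  generalize padicValNat 2 s = i at *
  subst hm
  have hodd : m % 2 = 1 := by
    by_contra h2
    exact h1 (by rw [pow_succ]; exact Nat.mul_dvd_mul_left _ (by omega))
  rw [pow_succ, ← Nat.mul_sub_one]
  exact Nat.mul_dvd_mul_left _ (by omega)

/-! ### The forest of the reduction from Dominating Set -/

namespace DomForest

variable (k n K : ℕ)

/-- The weight that the color `j` has at least. -/
def level (j : ℕ) : ℕ := (k + 1) * (n + 1) * (K / 2 ^ j)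

/-- The number of vertices. -/
def order : ℕ := (n * (k * n + 1) + k * n) * K

/-- The vertices come in blocks of size `K`, and these come in rows of size `k * n + 1`: this is the number
of the row. -/
def row (U : ℕ) : ℕ := U / K / (k * n + 1)

/-- The number of the block in its row. -/
def pos (U : ℕ) : ℕ := U / K % (k * n + 1)

/-- The vertex at the place `s` of the block `p` of the row `v`. -/
def vtx (v p s : ℕ) : ℕ := (v * (k * n + 1) + p) * K + s

/-- A block is a binomial tree, from which the subtrees at these vertices are detached. -/
def Detached (v p s : ℕ) : Prop :=
  (p = k * n ∧ ∃ j < k, s = 2 ^ (1 + j)) ∨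
    -- Here `p = i * n + u` codes a slot `i` and a vertex `u`. The first three detached vertices
    -- release the colors `0`, `1 + k + i` and `1 + i` at the root, the last one releases color `0`
    -- at the switch vertex.
    (p ≠ k * n ∧ (s = 1 ∨ s = 2 ^ (1 + k + p / n) ∨ (v < n ∧ s = 2 ^ (1 + p / n)) ∨
      s = 2 ^ (1 + 2 * k + p / n) + 1))

/-- The vertex `V` is the parent of the vertex `U`; `A` is the adjacency of the given graph. -/
def IsParent (A : ℕ → ℕ → Prop) (U V : ℕ) : Prop :=
  (U % K ≠ 0 ∧ V = U - 2 ^ padicValNat 2 (U % K) ∧ ¬Detached k n (row k n K U) (pos k n K U) (U % K)) ∨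
    -- The gadget root for `u` hangs below the root of row `v < n` exactly if `u` does not dominate
    -- `v`.
    (U % K = 0 ∧ pos k n K U ≠ k * n ∧ row k n K U < n ∧ pos k n K U % n ≠ row k n K U ∧
      ¬A (pos k n K U % n) (row k n K U) ∧ V = vtx k n K (row k n K U) (k * n) 0)

/-- The weights of the vertices. -/
def weight (U : ℕ) : ℕ :=
  if U % K = 0 then
    -- The root of a row is so light that its weight never restricts its color.
    if pos k n K U = k * n then 1
    else level k n K (1 + k + pos k n K U / n) +
      (if row k n K U < n then n - pos k n K U % n else n - 1 - pos k n K U % n)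
  else if pos k n K U ≠ k * n ∧ U % K = 2 ^ (1 + 2 * k + pos k n K U / n) then
    level k n K (1 + 2 * k + pos k n K U / n) + pos k n K U % n + 1
  else level k n K (padicValNat 2 (U % K))

/-- The target value. -/
def target : ℕ := ∑ j ∈ Finset.range (4 * k + 4), level k n K j + k * (n - 1)

variable {k n K}

theorem vtx_mod {v p s : ℕ} (hs : s < K) : vtx k n K v p s % K = s := by
  rw [vtx, Nat.mul_add_mod_of_lt hs]

theorem vtx_div {v p s : ℕ} (hs : s < K) : vtx k n K v p s / K = v * (k * n + 1) + p := by
  rw [vtx, mul_comm, Nat.mul_add_div (by omega), Nat.div_eq_of_lt hs, add_zero]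

theorem row_vtx {v p s : ℕ} (hs : s < K) (hp : p ≤ k * n) : row k n K (vtx k n K v p s) = v := by
  rw [row, vtx_div hs, mul_comm, Nat.mul_add_div (by omega), Nat.div_eq_of_lt (by omega), add_zero]

theorem pos_vtx {v p s : ℕ} (hs : s < K) (hp : p ≤ k * n) : pos k n K (vtx k n K v p s) = p := by
  rw [pos, vtx_div hs, Nat.mul_add_mod_of_lt (by omega)]

theorem vtx_row_pos (U : ℕ) : vtx k n K (row k n K U) (pos k n K U) (U % K) = U := by
  rw [vtx, row, pos, Nat.div_add_mod', Nat.div_add_mod']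

theorem pos_le (U : ℕ) : pos k n K U ≤ k * n := Nat.le_of_lt_succ (Nat.mod_lt _ (Nat.succ_pos _))

theorem vtx_lt_order {v p s : ℕ} (hs : s < K) (h : v * (k * n + 1) + p < n * (k * n + 1) + k * n) :
    vtx k n K v p s < order k n K := by
  rw [vtx, order]
  have := Nat.mul_le_mul_right K (Nat.succ_le_of_lt h)
  rw [Nat.succ_mul] at this
  omega

theorem row_pos_of_lt_order {U : ℕ} (h : U < order k n K) :
    row k n K U < n ∨ row k n K U = n ∧ pos k n K U < k * n := by
  have h1 : U / K < n * (k * n + 1) + k * n := Nat.div_lt_of_lt_mul (by rwa [mul_comm])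
  have h2 : row k n K U * (k * n + 1) + pos k n K U < n * (k * n + 1) + k * n := by
    rwa [row, pos, Nat.div_add_mod']
  rcases lt_trichotomy (row k n K U) n with h3 | h3 | h3
  · exact Or.inl h3
  · rw [h3] at h2
    exact Or.inr ⟨h3, by omega⟩
  · have := Nat.mul_le_mul_right (k * n + 1) (Nat.succ_le_of_lt h3)
    rw [Nat.succ_mul] at this
    omega

/-- A rank that decreases from a vertex to its parent. -/
def rank (k n K U : ℕ) : ℕ := (if pos k n K U = k * n then 0 else K) + U % K

theorem sub_pow_eq_vtx {U : ℕ} (hU : U % K ≠ 0) : U - 2 ^ padicValNat 2 (U % K) =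
    vtx k n K (row k n K U) (pos k n K U) (U % K - 2 ^ padicValNat 2 (U % K)) := by
  have h1 : 2 ^ padicValNat 2 (U % K) ≤ U % K := Nat.le_of_dvd (by omega) pow_padicValNat_dvd
  have h2 := vtx_row_pos (k := k) (n := n) (K := K) U
  rw [vtx] at h2 ⊢
  omega

/-- Inside a block, a parent has a smaller place than its child. Edges between blocks lead from
gadget roots to the root of a row, whose block has the lower ranks. -/
theorem isAcyclic {A : ℕ → ℕ → Prop} (hK : 0 < K) (N : ℕ) :
    (relGraph N (IsParent k n K A)).IsAcyclic := by
  refine relGraph_isAcyclic (rank k n K) ?_ ?_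
  · rintro U V V' (⟨h1, h2, -⟩ | ⟨h1, -, -, -, -, h2⟩) (⟨h3, h4, -⟩ | ⟨h3, -, -, -, -, h4⟩)
    · rw [h2, h4]
    · exact absurd h3 h1
    · exact absurd h1 h3
    · rw [h2, h4]
  · rintro U V (⟨h1, rfl, -⟩ | ⟨h1, h2, -, -, -, rfl⟩)
    · have h3 : 0 < 2 ^ padicValNat 2 (U % K) := by positivity
      have h4 := Nat.mod_lt U hK
      rw [sub_pow_eq_vtx h1, rank, rank, pos_vtx (by omega) (pos_le U), vtx_mod (by omega)]
      omega
    · rw [rank, rank, pos_vtx hK le_rfl, vtx_mod hK, if_pos rfl, if_neg h2]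
      omega

/-! ### From a coloring to a dominating set -/

theorem level_succ {r m : ℕ} (h : m < r) : level k n (2 ^ r) m = 2 * level k n (2 ^ r) (m + 1) := by
  rw [level, level, Nat.pow_div (by omega) (by omega), Nat.pow_div h (by omega),
    show r - m = r - (m + 1) + 1 by omega, pow_succ]
  ring

/-- A geometric series: two copies of `level m` complete the first `m` levels to the constant `2 *
level 0`. -/
theorem sum_level_add {r m : ℕ} (h : m ≤ r) :
    ∑ j ∈ Finset.range m, level k n (2 ^ r) j + 2 * level k n (2 ^ r) m = 2 * level k n (2 ^ r) 0 := by
  induction m with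
  | zero => simp
  | succ m ih =>
    have h1 := level_succ (k := k) (n := n) (m := m) (r := r) h
    rw [Finset.sum_range_succ, ← ih (by omega)]
    omega

theorem level_self (r : ℕ) : level k n (2 ^ r) r = (k + 1) * (n + 1) := by
  rw [level, Nat.div_self (by positivity), mul_one]

/-- The factor `(k + 1) * (n + 1)` in the levels makes twice `level (4 * k + 4)` larger than the
slack `k * (n - 1)`. -/
theorem target_lt : target k n (2 ^ (4 * k + 4)) < 2 * level k n (2 ^ (4 * k + 4)) 0 := by
  rw [target, ← sum_level_add (le_refl (4 * k + 4)), level_self]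
  have : k * (n - 1) ≤ k * n := Nat.mul_le_mul_left _ (Nat.sub_le _ _)
  nlinarith

end DomForest

/-! ### Light colorings and the forced colors of standard vertices -/

namespace DomForest

/-- The number of vertices of a block. -/
abbrev blockSize (k : ℕ) : ℕ := 2 ^ (4 * k + 4)

/-- A coloring of the forest whose weight does not exceed the target value, the colors being ordered by
decreasing weight; the color `j` has the weight `W j`. -/
structure LightColoring (k n : ℕ) (A : ℕ → ℕ → Prop) (col W : ℕ → ℕ) : Prop where
  col_lt : ∀ U < order k n (blockSize k), col U < 4 * k + 4
  weight_le : ∀ U < order k n (blockSize k), weight k n (blockSize k) U ≤ W (col U)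
  proper : ∀ U < order k n (blockSize k), ∀ V < order k n (blockSize k), U ≠ V →
    IsParent k n (blockSize k) A U V → col U ≠ col V
  anti : ∀ i j, i ≤ j → j < 4 * k + 4 → W j ≤ W i
  sum_le : ∑ j ∈ Finset.range (4 * k + 4), W j ≤ target k n (blockSize k)

/-- The number of a block that exists. -/
structure IsBlock (k n v p : ℕ) : Prop where
  lt : v * (k * n + 1) + p < n * (k * n + 1) + k * n
  le : p ≤ k * n

variable {k n : ℕ} {A : ℕ → ℕ → Prop} {col W : ℕ → ℕ}

theorem IsBlock.of_lt {v p : ℕ} (hv : v < n) (hp : p ≤ k * n) : IsBlock k n v p :=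
  ⟨by
    have := Nat.mul_le_mul_right (k * n + 1) (Nat.succ_le_of_lt hv)
    rw [Nat.succ_mul] at this
    omega, hp⟩

theorem IsBlock.last {p : ℕ} (hp : p < k * n) : IsBlock k n n p := ⟨by omega, hp.le⟩

theorem isParent_add_pow {v p s i : ℕ} (hp : p ≤ k * n) (hs : s < blockSize k) (hi : i < 4 * k + 4)
    (h : 2 ^ (i + 1) ∣ s) (hd : ¬Detached k n v p (s + 2 ^ i)) :
    IsParent k n (blockSize k) A (vtx k n (blockSize k) v p (s + 2 ^ i))
      (vtx k n (blockSize k) v p s) := by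
  have h1 := add_pow_lt_two_pow hi hs h
  have h2 : 0 < 2 ^ i := by positivity
  refine Or.inl ?_
  rw [vtx_mod h1, padicValNat_two_add_pow h, row_vtx h1 hp, pos_vtx h1 hp]
  refine ⟨by omega, ?_, hd⟩
  rw [vtx, vtx]
  omega

namespace LightColoring

variable (h : LightColoring k n A col W)
include h

/-- Otherwise the colors `j` and `j + 1` both weigh at least `level j`; together with the preceding
colors they reach `2 * level 0`, which is more than the target. -/
theorem lt_level {j : ℕ} (hj : j + 1 < 4 * k + 4)
    (hW : ∀ i < j, level k n (blockSize k) i ≤ W i) : W (j + 1) < level k n (blockSize k) j := by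
  by_contra! h1
  have h2 : W (j + 1) ≤ W j := h.anti _ _ (Nat.le_succ j) hj
  have h3 : ∑ i ∈ Finset.range (j + 1 + 1), W i ≤ ∑ i ∈ Finset.range (4 * k + 4), W i :=
    Finset.sum_le_sum_of_subset (Finset.range_mono (by omega))
  have h4 : ∑ i ∈ Finset.range j, level k n (blockSize k) i ≤ ∑ i ∈ Finset.range j, W i :=
    Finset.sum_le_sum fun i hi => hW i (Finset.mem_range.1 hi)
  rw [Finset.sum_range_succ, Finset.sum_range_succ] at h3
  have h5 := sum_level_add (k := k) (n := n) (m := j) (r := 4 * k + 4) (by omega)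
  have h6 := target_lt (k := k) (n := n)
  have h7 := h.sum_le
  simp only [blockSize] at *
  omega

end LightColoring

/-- The vertices of a block other than the root and, if there is one, the vertex with a modified weight. -/
structure IsStandard (k n p s : ℕ) : Prop where
  pos : s ≠ 0
  lt : s < blockSize k
  ne : p ≠ k * n → s ≠ 2 ^ (1 + 2 * k + p / n)

/-- Only children of the root and of the switch vertex are ever detached: a child of a nonroot
vertex is not a power of two, and `2 ^ (1 + 2 * k + p / n) + 1` is a child of the switch vertex. -/
theorem IsStandard.not_detached {v p s i : ℕ} (hs : IsStandard k n p s) (hi : 2 ^ (i + 1) ∣ s) :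
    ¬Detached k n v p (s + 2 ^ i) := by
  have hpow : ∀ m, s + 2 ^ i ≠ 2 ^ m := fun m hm => by
    have h1 := padicValNat_two_add_pow hi
    rw [hm, padicValNat.prime_pow] at h1
    have := hs.pos
    rw [h1] at hm
    omega
  rintro (⟨-, j, -, hj⟩ | ⟨h1, h2 | h2 | ⟨-, h2⟩ | h2⟩)
  · exact hpow _ hj
  · exact hpow 0 h2
  · exact hpow _ h2
  · exact hpow _ h2
  · rcases i with _ | i
    · exact hs.ne h1 (by simpa using h2)
    · have h3 : 2 ∣ s := (dvd_pow_self 2 (by omega)).trans hi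
      rw [pow_succ 2 i, show 1 + 2 * k + p / n = (2 * k + p / n) + 1 by ring, pow_succ] at h2
      omega

theorem IsStandard.add_pow {p s i : ℕ} (hs : s < blockSize k) (hs' : s = 0 → p ≠ k * n →
    i ≠ 1 + 2 * k + p / n) (hi : i < 4 * k + 4) (h : 2 ^ (i + 1) ∣ s) :
    IsStandard k n p (s + 2 ^ i) := by
  have hpos : 0 < 2 ^ i := by positivity
  refine ⟨by omega, add_pow_lt_two_pow hi hs h, fun hp h1 => ?_⟩
  have h2 := padicValNat_two_add_pow h
  rw [h1, padicValNat.prime_pow] at h2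
  rw [h2] at h1
  exact hs' (by omega) hp h2.symm

theorem weight_of_isStandard {v p s : ℕ} (hp : p ≤ k * n) (hs : IsStandard k n p s) :
    weight k n (blockSize k) (vtx k n (blockSize k) v p s) =
      level k n (blockSize k) (padicValNat 2 s) := by
  rw [weight, vtx_mod hs.lt, if_neg hs.pos, pos_vtx hs.lt hp, if_neg]
  rintro ⟨h1, h2⟩
  exact hs.ne h1 h2

namespace LightColoring

variable (h : LightColoring k n A col W)
include h

/-- A color `i < j` is taken by the child of valuation `i`, and colors above `j` are too light by
`lt_level`. Only the children of a vertex matter here, so detached vertices are covered too. -/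
theorem standard_aux (hn : 0 < n) (j : ℕ) : j < 4 * k + 4 → level k n (blockSize k) j ≤ W j ∧
    ∀ v p s, IsBlock k n v p → IsStandard k n p s → padicValNat 2 s = j →
      col (vtx k n (blockSize k) v p s) = j := by
  induction j using Nat.strong_induction_on with
  | _ j ih =>
    intro hj
    have hge : ∀ v p s, IsBlock k n v p → IsStandard k n p s → padicValNat 2 s = j →
        j ≤ col (vtx k n (blockSize k) v p s) := by
      intro v p s hb hs hsj
      by_contra! hlt
      set i := col (vtx k n (blockSize k) v p s) with hi
      have hdvd : 2 ^ (i + 1) ∣ s := (padicValNat_dvd_iff_le hs.pos).2 (by omega)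
      have hs' : IsStandard k n p (s + 2 ^ i) :=
        .add_pow hs.lt (fun h => absurd h hs.pos) (by omega) hdvd
      have h1 := (ih i hlt (by omega)).2 v p (s + 2 ^ i) hb hs' (padicValNat_two_add_pow hdvd)
      have hpos : 0 < 2 ^ i := by positivity
      refine h.proper _ (vtx_lt_order hs'.lt hb.lt) _ (vtx_lt_order hs.lt hb.lt) ?_
        (isParent_add_pow hb.le hs.lt (by omega) hdvd (hs.not_detached hdvd)) (h1.trans hi)
      rw [vtx, vtx]
      omega
    have hw : ∀ v p s, IsBlock k n v p → IsStandard k n p s → padicValNat 2 s = j →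
        level k n (blockSize k) j ≤ W (col (vtx k n (blockSize k) v p s)) := by
      intro v p s hb hs hsj
      rw [← hsj, ← weight_of_isStandard (v := v) hb.le hs]
      exact h.weight_le _ (vtx_lt_order hs.lt hb.lt)
    have hlt : ∀ v p s, IsBlock k n v p → IsStandard k n p s →
        col (vtx k n (blockSize k) v p s) < 4 * k + 4 :=
      fun v p s hb hs => h.col_lt _ (vtx_lt_order hs.lt hb.lt)
    constructor
    -- The block of a row's root has no switch vertex, so `2 ^ j` is standard in it for every `j`
    -- and witnesses the weight of color `j`.
    · have hb : IsBlock k n 0 (k * n) := .of_lt hn le_rfl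
      have hs : IsStandard k n (k * n) (0 + 2 ^ j) :=
        .add_pow (by positivity) (fun _ h => absurd rfl h) hj (dvd_zero _)
      have hj' := padicValNat_two_add_pow (dvd_zero (2 ^ (j + 1)))
      exact (hw _ _ _ hb hs hj').trans (h.anti _ _ (hge _ _ _ hb hs hj') (hlt _ _ _ hb hs))
    · intro v p s hb hs hsj
      by_contra hne
      have h1 := hge v p s hb hs hsj
      have h2 := hlt v p s hb hs
      have h3 := h.lt_level (j := j) (by omega) fun i hi => (ih i hi (by omega)).1
      have h4 := h.anti (j + 1) _ (by omega) h2
      have h5 := hw v p s hb hs hsj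
      omega

theorem level_le (hn : 0 < n) {j : ℕ} (hj : j < 4 * k + 4) : level k n (blockSize k) j ≤ W j :=
  (h.standard_aux hn j hj).1

theorem col_standard (hn : 0 < n) {v p s : ℕ} (hb : IsBlock k n v p) (hs : IsStandard k n p s) :
    col (vtx k n (blockSize k) v p s) = padicValNat 2 s :=
  (h.standard_aux hn _ (padicValNat_two_lt hs.pos hs.lt)).2 v p s hb hs rfl

/-- A vertex does not have the color of a standard child. -/
theorem col_ne (hn : 0 < n) {v p s i : ℕ} (hb : IsBlock k n v p) (hs : s < blockSize k)
    (hi : i < 4 * k + 4) (hdvd : 2 ^ (i + 1) ∣ s) (hs' : s = 0 → p ≠ k * n → i ≠ 1 + 2 * k + p / n)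
    (hd : ¬Detached k n v p (s + 2 ^ i)) : col (vtx k n (blockSize k) v p s) ≠ i := by
  have h1 : IsStandard k n p (s + 2 ^ i) := .add_pow hs hs' hi hdvd
  have h2 := h.col_standard hn hb h1
  rw [padicValNat_two_add_pow hdvd] at h2
  have hpos : 0 < 2 ^ i := by positivity
  have := h.proper _ (vtx_lt_order h1.lt hb.lt) _ (vtx_lt_order hs hb.lt) (by rw [vtx, vtx]; omega)
    (isParent_add_pow hb.le hs hi hdvd hd)
  omega

/-- The colors of a vertex are limited by its weight. -/
theorem col_le (hn : 0 < n) {U j : ℕ} (hU : U < order k n (blockSize k)) (hj : j < 4 * k + 4)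
    (hw : level k n (blockSize k) j ≤ weight k n (blockSize k) U) : col U ≤ j := by
  by_contra! hlt
  have h1 := h.col_lt U hU
  have h2 := h.lt_level (j := j) (by omega) fun i hi => h.level_le hn (by omega)
  have h3 := h.anti (j + 1) _ hlt h1
  have h4 := h.weight_le U hU
  omega

end LightColoring

end DomForest

/-! ### Gadgets and the choice they encode -/

namespace DomForest

variable {k n : ℕ} {A : ℕ → ℕ → Prop} {col W : ℕ → ℕ}

theorem gadget_lt {i u : ℕ} (hi : i < k) (hu : u < n) : i * n + u < k * n := by
  have := Nat.mul_le_mul_right n (Nat.succ_le_of_lt hi)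
  rw [Nat.succ_mul] at this
  omega

theorem gadget_div {i u : ℕ} (hu : u < n) : (i * n + u) / n = i := by
  rw [mul_comm, Nat.mul_add_div (by omega), Nat.div_eq_of_lt hu, add_zero]

theorem gadget_mod {i u : ℕ} (hu : u < n) : (i * n + u) % n = u := Nat.mul_add_mod_of_lt hu

theorem two_pow_lt_blockSize {j : ℕ} (hj : j < 4 * k + 4) : 2 ^ j < blockSize k :=
  Nat.pow_lt_pow_right (by omega) hj

theorem weight_gadget_root {v i u : ℕ} (hi : i < k) (hu : u < n) :
    weight k n (blockSize k) (vtx k n (blockSize k) v (i * n + u) 0) =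
      level k n (blockSize k) (1 + k + i) + if v < n then n - u else n - 1 - u := by
  have h0 : 0 < blockSize k := by positivity
  have h1 := gadget_lt hi hu
  rw [weight, vtx_mod h0, if_pos rfl, pos_vtx h0 h1.le, if_neg h1.ne, row_vtx h0 h1.le, gadget_div hu,
    gadget_mod hu]

theorem weight_gadget_switch {v i u : ℕ} (hi : i < k) (hu : u < n) :
    weight k n (blockSize k) (vtx k n (blockSize k) v (i * n + u) (2 ^ (1 + 2 * k + i))) =
      level k n (blockSize k) (1 + 2 * k + i) + u + 1 := by
  have h0 : 2 ^ (1 + 2 * k + i) < blockSize k := two_pow_lt_blockSize (by omega)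
  have h1 := gadget_lt hi hu
  rw [weight, vtx_mod h0, if_neg (by positivity), pos_vtx h0 h1.le, gadget_div hu, gadget_mod hu,
    if_pos ⟨h1.ne, rfl⟩]

theorem two_pow_ne_succ {j a : ℕ} (hj : 1 ≤ j) : 2 ^ j ≠ 2 ^ (a + 1) + 1 := by
  obtain ⟨j, rfl⟩ := Nat.exists_eq_add_of_le' hj
  rw [pow_succ, pow_succ]
  omega

theorem gadget_root_not_detached {v i u j : ℕ} (hi : i < k) (hu : u < n) (hj : 1 ≤ j)
    (hb : j ≠ 1 + k + i) (hc : v < n → j ≠ 1 + i) : ¬Detached k n v (i * n + u) (0 + 2 ^ j) := by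
  rw [zero_add]
  rintro (⟨h1, -⟩ | ⟨-, h2 | h2 | ⟨hv, h2⟩ | h2⟩)
  · exact (gadget_lt hi hu).ne h1
  · exact (Nat.one_lt_two_pow (by omega)).ne' h2
  · rw [gadget_div hu] at h2
    exact hb (Nat.pow_right_injective le_rfl h2)
  · rw [gadget_div hu] at h2
    exact hc hv (Nat.pow_right_injective le_rfl h2)
  · rw [gadget_div hu, show 1 + 2 * k + i = 2 * k + i + 1 by ring] at h2
    exact two_pow_ne_succ hj h2

theorem gadget_switch_not_detached {v i u j : ℕ} (hi : i < k) (hu : u < n) (hj : 1 ≤ j)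
    (hj' : j < 1 + 2 * k + i) : ¬Detached k n v (i * n + u) (2 ^ (1 + 2 * k + i) + 2 ^ j) := by
  have hpow : ∀ m, 2 ^ (1 + 2 * k + i) + 2 ^ j ≠ 2 ^ m := fun m hm => by
    have h1 := padicValNat_two_add_pow (pow_dvd_pow 2 hj')
    have h2 : 0 < 2 ^ (1 + 2 * k + i) := by positivity
    rw [hm, padicValNat.prime_pow] at h1
    rw [h1] at hm
    omega
  rintro (⟨h1, -⟩ | ⟨-, h2 | h2 | ⟨-, h2⟩ | h2⟩)
  · exact (gadget_lt hi hu).ne h1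
  · exact hpow 0 h2
  · exact hpow _ h2
  · exact hpow _ h2
  · rw [gadget_div hu] at h2
    have := Nat.one_lt_two_pow (n := j) (by omega)
    omega

namespace LightColoring

variable (h : LightColoring k n A col W)
include h

/-- The weight rules out colors above `1 + k + i`; the children still attached to the root rule out
all others but these. -/
theorem col_gadget_root {v i u : ℕ} (hi : i < k) (hu : u < n) (hb : IsBlock k n v (i * n + u)) :
    col (vtx k n (blockSize k) v (i * n + u) 0) = 0 ∨
      (v < n ∧ col (vtx k n (blockSize k) v (i * n + u) 0) = 1 + i) ∨
      col (vtx k n (blockSize k) v (i * n + u) 0) = 1 + k + i := by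
  have hn : 0 < n := by omega
  have h0 : 0 < blockSize k := by positivity
  have h1 : col (vtx k n (blockSize k) v (i * n + u) 0) ≤ 1 + k + i :=
    h.col_le hn (vtx_lt_order h0 hb.lt) (by omega) (by rw [weight_gadget_root hi hu]; omega)
  by_contra! h2
  refine h.col_ne (i := col (vtx k n (blockSize k) v (i * n + u) 0)) hn hb h0 (by omega) (dvd_zero _)
    (fun _ _ => ?_) (gadget_root_not_detached hi hu (by omega) h2.2.2 h2.2.1) rfl
  rw [gadget_div hu]
  omega

/-- The root occupies color `0`, the attached children of the switch vertex occupy `1, …, 2 * k +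
i`, and its weight forbids colors above `1 + 2 * k + i`. So it must pay in its own color. -/
theorem le_of_col_gadget_root_eq_zero {v i u : ℕ} (hi : i < k) (hu : u < n)
    (hb : IsBlock k n v (i * n + u)) (hcol : col (vtx k n (blockSize k) v (i * n + u) 0) = 0) :
    level k n (blockSize k) (1 + 2 * k + i) + u + 1 ≤ W (1 + 2 * k + i) := by
  have hn : 0 < n := by omega
  have h0 : 0 < blockSize k := by positivity
  have hlt : 2 ^ (1 + 2 * k + i) < blockSize k := two_pow_lt_blockSize (by omega)
  have hpos : 0 < 2 ^ (1 + 2 * k + i) := by positivity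
  have hw := weight_gadget_switch (v := v) hi hu
  have h1 : col (vtx k n (blockSize k) v (i * n + u) (2 ^ (1 + 2 * k + i))) ≤ 1 + 2 * k + i :=
    h.col_le hn (vtx_lt_order hlt hb.lt) (by omega) (by rw [hw]; omega)
  have h2 := isParent_add_pow (A := A) (v := v) (i := 1 + 2 * k + i) hb.le h0 (by omega) (dvd_zero _)
    (gadget_root_not_detached hi hu (by omega) (by omega) (by omega))
  rw [zero_add] at h2
  have h3 := h.proper _ (vtx_lt_order hlt hb.lt) _ (vtx_lt_order h0 hb.lt) (by rw [vtx, vtx]; omega) h2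
  rw [hcol] at h3
  have h4 : col (vtx k n (blockSize k) v (i * n + u) (2 ^ (1 + 2 * k + i))) = 1 + 2 * k + i := by
    by_contra hne
    have hlt' : col (vtx k n (blockSize k) v (i * n + u) (2 ^ (1 + 2 * k + i))) < 1 + 2 * k + i := by
      omega
    exact h.col_ne (i := col (vtx k n (blockSize k) v (i * n + u) (2 ^ (1 + 2 * k + i)))) hn hb hlt
      (by omega) (pow_dvd_pow 2 hlt') (fun h => absurd h hpos.ne')
      (gadget_switch_not_detached hi hu (by omega) hlt') rfl
  have h5 := h.weight_le _ (vtx_lt_order hlt hb.lt)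
  rwa [h4, hw] at h5

theorem le_of_col_gadget_root_eq {v i u : ℕ} (hi : i < k) (hu : u < n)
    (hb : IsBlock k n v (i * n + u))
    (hcol : col (vtx k n (blockSize k) v (i * n + u) 0) = 1 + k + i) :
    (level k n (blockSize k) (1 + k + i) + if v < n then n - u else n - 1 - u) ≤ W (1 + k + i) := by
  have h5 := h.weight_le _ (vtx_lt_order (by positivity) hb.lt)
  rwa [hcol, weight_gadget_root hi hu] at h5

/-- In row `n` each `u` demands excess `n - 1 - u` of color `1 + k + i` or `u + 1` of color `1 + 2 *
k + i`. Let `x` be least such that the former color has excess `n - 1 - x`; then the gadget of `x -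
1` must be paid by the latter, with excess at least `x`. -/
theorem exists_choice {i : ℕ} (hn : 0 < n) (hi : i < k) : ∃ x < n,
    level k n (blockSize k) (1 + 2 * k + i) + x ≤ W (1 + 2 * k + i) ∧
      level k n (blockSize k) (1 + k + i) + (n - 1 - x) ≤ W (1 + k + i) := by
  classical
  have hsel : ∀ u < n, level k n (blockSize k) (1 + k + i) + (n - 1 - u) ≤ W (1 + k + i) ∨
      level k n (blockSize k) (1 + 2 * k + i) + u + 1 ≤ W (1 + 2 * k + i) := by
    intro u hu
    have hb : IsBlock k n n (i * n + u) := .last (gadget_lt hi hu)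
    rcases h.col_gadget_root hi hu hb with h1 | ⟨h1, -⟩ | h1
    · exact Or.inr (h.le_of_col_gadget_root_eq_zero hi hu hb h1)
    · exact absurd h1 (lt_irrefl n)
    · have := h.le_of_col_gadget_root_eq hi hu hb h1
      rw [if_neg (lt_irrefl n)] at this
      exact Or.inl this
  have hex : ∃ x, level k n (blockSize k) (1 + k + i) + (n - 1 - x) ≤ W (1 + k + i) :=
    ⟨n - 1, by rw [Nat.sub_self]; exact h.level_le hn (by omega)⟩
  have hfind := Nat.find_spec hex
  have hle : Nat.find hex ≤ n - 1 :=
    Nat.find_min' hex (by rw [Nat.sub_self]; exact h.level_le hn (by omega))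
  refine ⟨Nat.find hex, by omega, ?_, hfind⟩
  rcases Nat.eq_zero_or_pos (Nat.find hex) with h0 | h0
  · rw [h0]
    exact h.level_le hn (by omega)
  · have h1 := Nat.find_min hex (m := Nat.find hex - 1) (by omega)
    rcases hsel (Nat.find hex - 1) (by omega) with h2 | h2
    · exact absurd h2 h1
    · omega

/-- The weights of the colors that encode the chosen vertices. -/
theorem choice_eq (hn : 0 < n) {x : ℕ → ℕ} (hx : ∀ i < k, x i < n ∧
    level k n (blockSize k) (1 + 2 * k + i) + x i ≤ W (1 + 2 * k + i) ∧
      level k n (blockSize k) (1 + k + i) + (n - 1 - x i) ≤ W (1 + k + i)) {i : ℕ} (hi : i < k) :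
    W (1 + 2 * k + i) = level k n (blockSize k) (1 + 2 * k + i) + x i ∧
      W (1 + k + i) = level k n (blockSize k) (1 + k + i) + (n - 1 - x i) := by
  set e : ℕ → ℕ := fun j => W j - level k n (blockSize k) j with he
  have he' : ∀ j < 4 * k + 4, W j = level k n (blockSize k) j + e j := fun j hj => by
    have := h.level_le hn hj
    simp only [he]
    omega
  have h1 : ∑ j ∈ Finset.range (4 * k + 4), e j ≤ k * (n - 1) := by
    have h2 := h.sum_le
    rw [target, Finset.sum_congr rfl fun j hj => he' j (Finset.mem_range.1 hj),
      Finset.sum_add_distrib] at h2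
    omega
  -- The colors `0, …, k`, the two groups of `k` colors that encode the choice, and `k + 3` further
  -- colors.
  rw [show 4 * k + 4 = 1 + k + k + k + (k + 3) by ring] at h1
  simp only [Finset.sum_range_add e] at h1
  have h3 : ∑ i ∈ Finset.range k, (e (1 + k + i) + e (1 + k + k + i)) ≤ k * (n - 1) := by
    rw [Finset.sum_add_distrib]
    omega
  have h4 : ∀ i < k, x i ≤ e (1 + k + k + i) ∧ n - 1 - x i ≤ e (1 + k + i) := by
    intro i hi
    have h5 := hx i hi
    have h6 := he' (1 + k + i) (by omega)
    have h7 := he' (1 + 2 * k + i) (by omega)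
    rw [show 1 + k + k + i = 1 + 2 * k + i by ring]
    omega
  -- Every pair has excess at least `n - 1` and the slack is `k * (n - 1)`, so no pair can have
  -- more.
  have h8 : e (1 + k + i) + e (1 + k + k + i) ≤ n - 1 := by
    by_contra! h9
    have h10 : ∑ _i ∈ Finset.range k, (n - 1) <
        ∑ i ∈ Finset.range k, (e (1 + k + i) + e (1 + k + k + i)) := by
      refine Finset.sum_lt_sum (fun j hj => ?_) ⟨i, Finset.mem_range.2 hi, h9⟩
      have h11 := h4 j (Finset.mem_range.1 hj)
      have h12 := (hx j (Finset.mem_range.1 hj)).1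
      omega
    rw [Finset.sum_const, Finset.card_range, smul_eq_mul] at h10
    omega
  have h13 := h4 i hi
  have h14 := (hx i hi).1
  have h6 := he' (1 + k + i) (by omega)
  have h7 := he' (1 + 2 * k + i) (by omega)
  rw [show 1 + k + k + i = 1 + 2 * k + i by ring] at h8 h13
  omega

/-- Every child of the root forbids its valuation as a color, except the detached ones, of
valuations `1, …, k`. -/
theorem col_root (hn : 0 < n) {v : ℕ} (hv : v < n) :
    ∃ i < k, col (vtx k n (blockSize k) v (k * n) 0) = 1 + i := by
  have h0 : 0 < blockSize k := by positivity
  have hb : IsBlock k n v (k * n) := .of_lt hv le_rfl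
  have h1 := h.col_lt _ (vtx_lt_order h0 hb.lt)
  by_contra! h2
  refine h.col_ne (i := col (vtx k n (blockSize k) v (k * n) 0)) hn hb h0 h1 (dvd_zero _)
    (fun _ h => absurd rfl h) ?_ rfl
  rw [zero_add]
  rintro (⟨-, i, hi, h3⟩ | ⟨h3, -⟩)
  · exact h2 i hi (Nat.pow_right_injective le_rfl h3)
  · exact h3 rfl

/-- The vertices that a light coloring encodes are a dominating set. -/
theorem exists_dominating (hn : 0 < n) : ∃ x : ℕ → ℕ, (∀ i < k, x i < n) ∧
    ∀ v < n, ∃ i < k, x i = v ∨ A (x i) v := by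
  choose! x hx using fun i (hi : i < k) => h.exists_choice hn hi
  refine ⟨x, fun i hi => (hx i hi).1, fun v hv => ?_⟩
  obtain ⟨i, hi, hcol⟩ := h.col_root hn hv
  refine ⟨i, hi, ?_⟩
  by_contra! hne
  have hu := (hx i hi).1
  have h0 : 0 < blockSize k := by positivity
  have hlt := gadget_lt hi hu
  have hb : IsBlock k n v (i * n + x i) := .of_lt hv hlt.le
  have hb' : IsBlock k n v (k * n) := .of_lt hv le_rfl
  have hP : IsParent k n (blockSize k) A (vtx k n (blockSize k) v (i * n + x i) 0)
      (vtx k n (blockSize k) v (k * n) 0) := by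
    refine Or.inr ?_
    rw [vtx_mod h0, pos_vtx h0 hlt.le, row_vtx h0 hlt.le, gadget_mod hu]
    exact ⟨rfl, hlt.ne, hv, hne.1, hne.2, rfl⟩
  have h1 := h.proper _ (vtx_lt_order h0 hb.lt) _ (vtx_lt_order h0 hb'.lt) (by
    intro h2
    have := congrArg (pos k n (blockSize k)) h2
    rw [pos_vtx h0 hlt.le, pos_vtx h0 le_rfl] at this
    omega) hP
  have h2 := h.choice_eq hn hx hi
  -- The gadget of the chosen vertex lacks one unit of excess for color `0` as well as for `1 + k +
  -- i`, and color `1 + i` is that of its neighbor, the root of the row.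
  rcases h.col_gadget_root hi hu hb with h3 | ⟨-, h3⟩ | h3
  · have := h.le_of_col_gadget_root_eq_zero hi hu hb h3
    omega
  · rw [hcol] at h1
    exact h1 h3
  · have := h.le_of_col_gadget_root_eq hi hu hb h3
    rw [if_pos hv] at this
    omega

end LightColoring

end DomForest

namespace DomForest

/-! ### From a dominating set to a coloring -/

variable {k n : ℕ}

theorem level_anti {K i j : ℕ} (h : i ≤ j) : level k n K j ≤ level k n K i :=
  Nat.mul_le_mul_left _ (Nat.div_le_div_left (Nat.pow_le_pow_right (by omega) h) (by positivity))

theorem le_level {r j : ℕ} (h : j ≤ r) : n + 1 ≤ level k n (2 ^ r) j := by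
  refine le_trans ?_ (level_anti h)
  rw [level_self]
  exact Nat.le_mul_of_pos_left _ (Nat.succ_pos k)

/-- The terms added to levels in the weights are at most `n`, so a modified vertex also fits into
every color of smaller index. -/
theorem level_add_le {r i j : ℕ} (hi : i < j) (hj : j ≤ r) :
    level k n (2 ^ r) j + n ≤ level k n (2 ^ r) i := by
  obtain ⟨j, rfl⟩ := Nat.exists_eq_add_of_lt hi
  have h1 : level k n (2 ^ r) (i + j) ≤ level k n (2 ^ r) i := level_anti (by omega)
  have h2 := level_succ (k := k) (n := n) (r := r) (m := i + j) (by omega)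
  have h3 := le_level (k := k) (n := n) hj
  omega

/-- The difference of the weight of a color and its level. -/
def extra (k n : ℕ) (x : ℕ → ℕ) (j : ℕ) : ℕ :=
  if j < 1 + k then 0 else if j < 1 + k + k then n - 1 - x (j - (1 + k))
  else if j < 1 + k + k + k then x (j - (1 + k + k)) else 0

theorem extra_left {x : ℕ → ℕ} {i : ℕ} (hi : i < k) : extra k n x (1 + k + i) = n - 1 - x i := by
  rw [extra, if_neg (by omega), if_pos (by omega), Nat.add_sub_cancel_left]

theorem extra_right {x : ℕ → ℕ} {i : ℕ} (hi : i < k) : extra k n x (1 + k + k + i) = x i := by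
  rw [extra, if_neg (by omega), if_neg (by omega), if_pos (by omega), Nat.add_sub_cancel_left]

theorem sum_extra {x : ℕ → ℕ} (hx : ∀ i < k, x i < n) :
    ∑ j ∈ Finset.range (4 * k + 4), extra k n x j = k * (n - 1) := by
  rw [show 4 * k + 4 = 1 + k + k + k + (k + 3) by ring, Finset.sum_range_add, Finset.sum_range_add,
    Finset.sum_range_add (extra k n x) (1 + k) k]
  have h1 : ∑ j ∈ Finset.range (1 + k), extra k n x j = 0 :=
    Finset.sum_eq_zero fun j hj => if_pos (Finset.mem_range.1 hj)
  have h2 : ∑ j ∈ Finset.range (k + 3), extra k n x (1 + k + k + k + j) = 0 :=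
    Finset.sum_eq_zero fun j _ => by
      rw [extra, if_neg (by omega), if_neg (by omega), if_neg (by omega)]
  rw [h1, h2, Finset.sum_congr rfl fun i hi => extra_left (n := n) (x := x) (Finset.mem_range.1 hi),
    Finset.sum_congr rfl fun i hi => extra_right (n := n) (x := x) (Finset.mem_range.1 hi), zero_add,
    add_zero, ← Finset.sum_add_distrib,
    Finset.sum_congr rfl fun i hi => Nat.sub_add_cancel (?_ : x i ≤ n - 1), Finset.sum_const,
    Finset.card_range, smul_eq_mul]
  have := hx i (Finset.mem_range.1 hi)
  omega

/-- The coloring for the vertices `x i`, where `x (d v)` dominates the vertex `v`. -/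
def domColor (k n : ℕ) (x d : ℕ → ℕ) (v p s : ℕ) : ℕ :=
  if s = 0 then
    if p = k * n then 1 + d v
    else if p % n < x (p / n) then 0
    else if v < n ∧ p % n = x (p / n) then 1 + p / n
    else 1 + k + p / n
  else if p ≠ k * n ∧ s = 2 ^ (1 + 2 * k + p / n) then
    if p % n < x (p / n) then 1 + 2 * k + p / n else 0
  else padicValNat 2 s

variable {A : ℕ → ℕ → Prop} {x d : ℕ → ℕ}

theorem div_lt_of_ne {p : ℕ} (hp : p ≤ k * n) (hne : p ≠ k * n) : p / n < k :=
  Nat.div_lt_of_lt_mul (by rw [mul_comm]; omega)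

theorem domColor_lt {v p s : ℕ} (hd : ∀ v < n, d v < k) (hv : v < n ∨ v = n ∧ p < k * n)
    (hp : p ≤ k * n) (hs : s < blockSize k) : domColor k n x d v p s < 4 * k + 4 := by
  have h1 : p ≠ k * n → p / n < k := div_lt_of_ne hp
  rw [domColor]
  split_ifs with h2 h3 h4 h5 h6 h7
  · have := hd v (by omega)
    omega
  · omega
  · have := h1 h3
    omega
  · have := h1 h3
    omega
  · have := h1 h6.1
    omega
  · omega
  · exact padicValNat_two_lt h2 hs

theorem weight_le_domColor {U : ℕ} (hd : ∀ v < n, d v < k) (hU : U < order k n (blockSize k)) :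
    weight k n (blockSize k) U ≤
      level k n (blockSize k)
        (domColor k n x d (row k n (blockSize k) U) (pos k n (blockSize k) U) (U % blockSize k)) +
      extra k n x
        (domColor k n x d (row k n (blockSize k) U) (pos k n (blockSize k) U) (U % blockSize k)) := by
  have hv := row_pos_of_lt_order hU
  have hp := pos_le (k := k) (n := n) (K := blockSize k) U
  rw [weight]
  generalize row k n (blockSize k) U = v at *
  generalize pos k n (blockSize k) U = p at *
  generalize U % blockSize k = s
  have h1 : p ≠ k * n → p / n < k := div_lt_of_ne hp
  have h0 : p ≠ k * n → p % n < n := fun h => Nat.mod_lt _ (Nat.pos_of_ne_zero (by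
    rintro rfl
    omega))
  rw [domColor]
  generalize p / n = i at *
  generalize p % n = u at *
  have hle : ∀ j ≤ 4 * k + 4, ∀ i < j, level k n (blockSize k) j + n ≤ level k n (blockSize k) i :=
    fun j hj i hi => level_add_le hi hj
  by_cases hs : s = 0
  · rw [if_pos hs, if_pos hs]
    by_cases hpk : p = k * n
    · rw [if_pos hpk, if_pos hpk]
      have h2 := hd v (by omega)
      have := le_level (k := k) (n := n) (r := 4 * k + 4) (j := 1 + d v) (by omega)
      simp only [blockSize]
      omega
    · rw [if_neg hpk, if_neg hpk]
      have h2 := h1 hpk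
      have h4 := h0 hpk
      -- If color `1 + k + i` is used, then `u > x i` in rows `v < n` and `u ≥ x i` in row `n`;
      -- either way the excess `n - 1 - x i` suffices.
      obtain ⟨w, hw, h3, h3'⟩ : ∃ w, (if v < n then n - u else n - 1 - u) = w ∧ w ≤ n ∧
          (¬u < x i → ¬(v < n ∧ u = x i) → w ≤ n - 1 - x i) := by
        refine ⟨_, rfl, ?_, ?_⟩ <;> split_ifs <;> omega
      rw [hw]
      split_ifs with h5 h6
      · have := hle (1 + k + i) (by omega) 0 (by omega)
        omega
      · have := hle (1 + k + i) (by omega) (1 + i) (by omega)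
        omega
      · rw [extra_left h2]
        have := h3' h5 h6
        omega
  · rw [if_neg hs, if_neg hs]
    by_cases hY : p ≠ k * n ∧ s = 2 ^ (1 + 2 * k + i)
    · rw [if_pos hY, if_pos hY]
      have h2 := h1 hY.1
      have h4 := h0 hY.1
      split_ifs with h5
      · rw [show 1 + 2 * k + i = 1 + k + k + i by ring, extra_right h2]
        omega
      · have := hle (1 + 2 * k + i) (by omega) 0 (by omega)
        omega
    · rw [if_neg hY, if_neg hY]
      omega

/-- Standard vertices are colored by valuation, which grows towards the root. A gadget or row root
only uses colors of its detached children, and so does the switch vertex when it has color `0`; it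
does so exactly when the gadget root does not. -/
theorem domColor_ne {v p s : ℕ} (hd : ∀ v < n, d v < k) (hv : v < n ∨ v = n ∧ p < k * n)
    (hs : s ≠ 0) (hdet : ¬Detached k n v p s) :
    domColor k n x d v p s ≠ domColor k n x d v p (s - 2 ^ padicValNat 2 s) := by
  have hdvd : 2 ^ padicValNat 2 s ≤ s := Nat.le_of_dvd (by omega) pow_padicValNat_dvd
  have hpos : 0 < 2 ^ padicValNat 2 s := by positivity
  rw [domColor, if_neg hs]
  by_cases hY : p ≠ k * n ∧ s = 2 ^ (1 + 2 * k + p / n)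
  · have ht : s - 2 ^ padicValNat 2 s = 0 := by rw [hY.2, padicValNat.prime_pow, Nat.sub_self]
    rw [if_pos hY, ht, domColor, if_pos rfl, if_neg hY.1]
    generalize p / n = i at *
    split_ifs <;> omega
  · rw [if_neg hY]
    by_cases ht : s - 2 ^ padicValNat 2 s = 0
    · have hs' : s = 2 ^ padicValNat 2 s := by omega
      rw [domColor, if_pos ht]
      generalize padicValNat 2 s = j at *
      subst hs'
      by_cases hpk : p = k * n
      · rw [if_pos hpk]
        rintro rfl
        exact hdet (Or.inl ⟨hpk, d v, hd v (by omega), rfl⟩)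
      · rw [if_neg hpk]
        split_ifs with h1 h2
        · rintro rfl
          exact hdet (Or.inr ⟨hpk, Or.inl rfl⟩)
        · rintro rfl
          exact hdet (Or.inr ⟨hpk, Or.inr (Or.inr (Or.inl ⟨h2.1, rfl⟩))⟩)
        · rintro rfl
          exact hdet (Or.inr ⟨hpk, Or.inr (Or.inl rfl)⟩)
    · have hlt := padicValNat_sub_pow hs ht
      rw [domColor, if_neg ht]
      by_cases hY' : p ≠ k * n ∧ s - 2 ^ padicValNat 2 s = 2 ^ (1 + 2 * k + p / n)
      · rw [if_pos hY']
        rw [hY'.2, padicValNat.prime_pow] at hlt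
        split_ifs with h1
        · exact hlt.ne
        · intro h2
          rw [h2] at hY' hdvd
          exact hdet (Or.inr ⟨hY'.1, Or.inr (Or.inr (Or.inr (by omega)))⟩)
      · rw [if_neg hY']
        exact hlt.ne

theorem sigma_le_target {N : ℕ} (hN : N = order k n (blockSize k)) (hx : ∀ i < k, x i < n)
    (hd : ∀ v < n, d v < k) (hdom : ∀ v < n, x (d v) = v ∨ A (x (d v)) v) :
    sigma (relGraph N (IsParent k n (blockSize k) A))
      (fun U => ((weight k n (blockSize k) U : ℕ) : ℝ≥0)) (4 * k + 4) ≤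
        ((target k n (blockSize k) : ℝ≥0) : ℝ≥0∞) := by
  subst hN
  have h0 : 0 < blockSize k := by positivity
  refine sigma_le_of_colors (fun U => domColor k n x d (row k n (blockSize k) U)
    (pos k n (blockSize k) U) (U % blockSize k))
    (fun j => level k n (blockSize k) j + extra k n x j) ?_ ?_ ?_ ?_
  · exact fun U hU => domColor_lt hd (row_pos_of_lt_order hU) (pos_le U) (Nat.mod_lt _ h0)
  · exact fun U hU => weight_le_domColor hd hU
  · rintro U hU V - (⟨h1, rfl, h2⟩ | ⟨h1, h2, h3, h4, h5, rfl⟩)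
    · have h3 := Nat.mod_lt U h0
      have h4 : 0 < 2 ^ padicValNat 2 (U % blockSize k) := by positivity
      rw [sub_pow_eq_vtx (k := k) (n := n) h1, row_vtx (by omega) (pos_le U),
        pos_vtx (by omega) (pos_le U), vtx_mod (by omega)]
      exact domColor_ne hd (row_pos_of_lt_order hU) h1 h2
    · rw [row_vtx h0 le_rfl, pos_vtx h0 le_rfl, vtx_mod h0, h1]
      have h6 := hd _ h3
      have h7 := hdom _ h3
      rw [domColor, domColor, if_pos rfl, if_neg h2, if_pos rfl, if_pos rfl]
      generalize pos k n (blockSize k) U / n = i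
      split_ifs with h8 h9
      · omega
      -- Equal colors would give `d v = i`, so `x i` would dominate `v`; but the edge exists only if
      -- it does not.
      · intro h10
        rw [show d _ = i by omega, ← h9.2] at h7
        exact h7.elim h4 h5
      · omega
  · rw [Finset.sum_add_distrib, sum_extra hx, target]

/-- The target value can be reached if and only if there is a dominating set. -/
theorem sigma_le_target_iff {N : ℕ} (hN : N = order k n (blockSize k)) :
    sigma (relGraph N (IsParent k n (blockSize k) A))
      (fun U => ((weight k n (blockSize k) U : ℕ) : ℝ≥0)) (4 * k + 4) ≤
        ((target k n (blockSize k) : ℝ≥0) : ℝ≥0∞) ↔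
    ∃ x : ℕ → ℕ, ∀ v < n, ∃ i < k, x i < n ∧ (x i = v ∨ A (x i) v) := by
  -- For `n = 0` the forest is empty and both sides hold; the general argument needs a block in row
  -- `0`.
  rcases Nat.eq_zero_or_pos n with rfl | hn
  · have hN0 : N = 0 := by rw [hN, order]; ring
    subst hN0
    refine ⟨fun _ => ⟨fun _ => 0, by simp⟩, fun _ => ?_⟩
    exact sigma_le_of_colors (fun _ => 0) (fun _ => 0) (by simp) (by simp) (by simp) (by simp)
  · constructor
    · intro h
      obtain ⟨col, W, h1, h2, h3, h4, h5⟩ := exists_antitone_of_sigma_le h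
      subst hN
      obtain ⟨x, hx, hdom⟩ := LightColoring.exists_dominating ⟨h1, h2, h3, h4, h5⟩ hn
      refine ⟨x, fun v hv => ?_⟩
      obtain ⟨i, hi, hiv⟩ := hdom v hv
      exact ⟨i, hi, hx i hi, hiv⟩
    · rintro ⟨x, hdom⟩
      choose! d hd using hdom
      -- Slots that hold no vertex are reset to the vertex `0`.
      refine sigma_le_target (x := fun i => if x i < n then x i else 0) hN (fun i _ => ?_)
        (fun v hv => (hd v hv).1) fun v hv => ?_
      · split_ifs <;> omega
      · obtain ⟨-, h1, h2⟩ := hd v hv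
        simpa only [h1, if_true] using h2

end DomForest

/-! ### Computing the forest in polynomial time -/

namespace StackProg

open Computability (Γ')

/-- In this lemma and the next two, the power may be exponential, but capping it leaves the result
unchanged. -/
theorem PolyFun.sub_two_pow {f g} (hf : PolyFun f) (hg : PolyFun g) :
    PolyFun fun x e => f x e - 2 ^ g x e :=
  (hf.sub (PolyFun.min_two_pow hg hf)).congr fun x e => by omega

theorem PolyFun.div_two_pow {f g} (hf : PolyFun f) (hg : PolyFun g) :
    PolyFun fun x e => f x e / 2 ^ g x e :=
  (hf.div (PolyFun.min_two_pow hg hf.succ)).congr fun x e => by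
    rcases le_total (2 ^ g x e) (f x e + 1) with h | h
    · rw [min_eq_left h]
    · rw [min_eq_right h, Nat.div_eq_of_lt (Nat.lt_succ_self _)]
      rcases h.eq_or_lt with h | h
      · rw [← h, Nat.div_eq_of_lt (Nat.lt_succ_self _)]
      · rw [Nat.div_eq_of_lt (by omega)]

theorem PolyPred.eq_two_pow {f g} (hf : PolyFun f) (hg : PolyFun g) :
    PolyPred fun x e => f x e = 2 ^ g x e :=
  (PolyPred.eq hf (PolyFun.min_two_pow hg hf.succ)).congr fun x e => by omega

theorem PolyFun.padicValNat_two {f} (hf : PolyFun f) : PolyFun fun x e => padicValNat 2 (f x e) := by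
  classical
  -- The valuation counts the `j` with `2 ^ (j + 1) ∣ s`. The cap `s + 1` divides no positive `s`,
  -- and for `s = 0` the range is empty.
  refine (PolyFun.card (P := fun x e j => min (2 ^ (j + 1)) (f x e + 1) ∣ f x e) hf
    (PolyPred.dvd (PolyFun.min_two_pow (PolyFun.var 0).succ (hf.rename (· + 1)).succ)
      (hf.rename (· + 1)))).congr fun x e => ?_
  generalize f x e = s
  rcases Nat.eq_zero_or_pos s with rfl | hs
  · simp
  · have h1 : (Finset.range s).filter (fun j => min (2 ^ (j + 1)) (s + 1) ∣ s) =
        Finset.range (padicValNat 2 s) := by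
      ext j
      rw [Finset.mem_filter, Finset.mem_range, Finset.mem_range,
        show j < padicValNat 2 s ↔ _ from (padicValNat_dvd_iff_le hs.ne').symm]
      constructor
      · rintro ⟨-, h⟩
        rcases le_total (2 ^ (j + 1)) (s + 1) with h2 | h2
        · rwa [min_eq_left h2] at h
        · rw [min_eq_right h2] at h
          have := Nat.le_of_dvd hs h
          omega
      · intro h
        have h2 := Nat.le_of_dvd hs h
        rw [min_eq_left (by omega)]
        exact ⟨(Nat.lt_two_pow_self.trans (Nat.pow_lt_pow_right (by omega) (Nat.lt_succ_self j))).trans_le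
          h2, h⟩
    rw [← Finset.card_range (padicValNat 2 s), ← h1]
    congr

end StackProg

namespace DomForest

open StackProg

variable {k n K U V j v p s : List Bool → (ℕ → ℕ) → ℕ}

theorem polyFun_level (hk : PolyFun k) (hn : PolyFun n) (hK : PolyFun K) (hj : PolyFun j) :
    PolyFun fun x e => level (k x e) (n x e) (K x e) (j x e) :=
  (hk.succ.mul hn.succ).mul (hK.div_two_pow hj)

theorem polyFun_order (hk : PolyFun k) (hn : PolyFun n) (hK : PolyFun K) :
    PolyFun fun x e => order (k x e) (n x e) (K x e) :=
  ((hn.mul (hk.mul hn).succ).add (hk.mul hn)).mul hK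

theorem polyFun_row (hk : PolyFun k) (hn : PolyFun n) (hK : PolyFun K) (hU : PolyFun U) :
    PolyFun fun x e => row (k x e) (n x e) (K x e) (U x e) :=
  (hU.div hK).div (hk.mul hn).succ

theorem polyFun_pos (hk : PolyFun k) (hn : PolyFun n) (hK : PolyFun K) (hU : PolyFun U) :
    PolyFun fun x e => pos (k x e) (n x e) (K x e) (U x e) :=
  (hU.div hK).mod (hk.mul hn).succ

theorem polyPred_detached (hk : PolyFun k) (hn : PolyFun n) (hv : PolyFun v) (hp : PolyFun p)
    (hs : PolyFun s) : PolyPred fun x e => Detached (k x e) (n x e) (v x e) (p x e) (s x e) := by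
  have h1 : ∀ {f}, PolyFun f → PolyFun fun x e => 1 + f x e := fun hf => (PolyFun.const 1).add hf
  have hd := hp.div hn
  refine ((PolyPred.eq hp (hk.mul hn)).and (PolyPred.exists_lt (P := fun x e j => s x e = 2 ^ (1 + j)) hk
    (PolyPred.eq_two_pow (hs.rename (· + 1)) (h1 (.var 0))))).or
    ((PolyPred.eq hp (hk.mul hn)).not.and ((PolyPred.eq hs (.const 1)).or
      ((PolyPred.eq_two_pow hs ((h1 hk).add hd)).or
        (((PolyPred.lt hv hn).and (PolyPred.eq_two_pow hs (h1 hd))).or ?_))))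
  refine ((PolyPred.eq_two_pow hs.pred
    ((h1 ((PolyFun.const 2).mul hk)).add hd)).and (PolyPred.lt .zero hs)).congr fun x e => ?_
  have := Nat.two_pow_pos (1 + 2 * k x e + p x e / n x e)
  omega

theorem polyPred_isParent (hk : PolyFun k) (hn : PolyFun n) (hK : PolyFun K) (hU : PolyFun U)
    (hV : PolyFun V) : PolyPred fun x e => IsParent (k x e) (n x e) (K x e)
      (fun u v => x.getD (u * n x e + v) false = true) (U x e) (V x e) := by
  have hs := hU.mod hK
  have hr := polyFun_row hk hn hK hU
  have hp := polyFun_pos hk hn hK hU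
  have hkn := hk.mul hn
  have hu := hp.mod hn
  exact ((PolyPred.eq hs .zero).not.and ((PolyPred.eq hV (hU.sub_two_pow hs.padicValNat_two)).and
    (polyPred_detached hk hn hr hp hs).not)).or ((PolyPred.eq hs .zero).and
      ((PolyPred.eq hp hkn).not.and ((PolyPred.lt hr hn).and ((PolyPred.eq hu hr).not.and
        ((PolyPred.bit ((hu.mul hn).add hr)).not.and
          (PolyPred.eq hV ((((hr.mul hkn.succ).add hkn).mul hK).add .zero)))))))

theorem polyFun_weight (hk : PolyFun k) (hn : PolyFun n) (hK : PolyFun K) (hU : PolyFun U) :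
    PolyFun fun x e => weight (k x e) (n x e) (K x e) (U x e) := by
  have hs := hU.mod hK
  have hr := polyFun_row hk hn hK hU
  have hp := polyFun_pos hk hn hK hU
  have hkn := hk.mul hn
  have hu := hp.mod hn
  have hi := hp.div hn
  have hb := ((PolyFun.const 1).add hk).add hi
  have ha := ((PolyFun.const 1).add ((PolyFun.const 2).mul hk)).add hi
  refine (PolyFun.ite (PolyPred.eq hs .zero) (PolyFun.ite (PolyPred.eq hp hkn) (.const 1)
    ((polyFun_level hk hn hK hb).add (PolyFun.ite (PolyPred.lt hr hn) (hn.sub hu) (hn.pred.sub hu))))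
    (PolyFun.ite ((PolyPred.eq hp hkn).not.and (PolyPred.eq_two_pow hs ha))
      ((polyFun_level hk hn hK ha).add hu).succ
      (polyFun_level hk hn hK hs.padicValNat_two))).congr fun x e => ?_
  rw [weight]
  congr

theorem polyFun_target (hk : PolyFun k) (hn : PolyFun n) (hK : PolyFun K) :
    PolyFun fun x e => target (k x e) (n x e) (K x e) :=
  (PolyFun.sum (h := fun x e j => level (k x e) (n x e) (K x e) j)
    (((PolyFun.const 4).mul hk).add (.const 4)) (polyFun_level (hk.rename (· + 1)) (hn.rename (· + 1))
      (hK.rename (· + 1)) (.var 0))).add (hk.mul hn.pred)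

open Classical in
/-- The word of the instance to which a graph is mapped, whose adjacency matrix has the entries `x`. -/
noncomputable def outWord (x : List Bool) (k n K : ℕ) : List Computability.Γ' :=
  unaryWord (4 * k + 4) ++
    ((unaryWord (order k n K) ++ (List.range (order k n K)).flatMap fun U =>
      (List.range (order k n K)).flatMap fun V => [Computability.Γ'.bit (decide (U ≠ V ∧
        (IsParent k n K (fun u v => x.getD (u * n + v) false = true) U V ∨
          IsParent k n K (fun u v => x.getD (u * n + v) false = true) V U)))]) ++
    (((List.range (order k n K)).flatMap fun U => binaryWord (weight k n K U) ++ binaryWord 1) ++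
      (binaryWord (target k n K) ++ binaryWord 1)))

/-- Inside `m` nested loops the original variables are shifted by `m`, and variable 0 is the
innermost index. -/
theorem emits_outWord : Emits fun x e => outWord x (e 0) (e 1) (e 2) := by
  have hN : ∀ i, PolyFun fun _ e => order (e i) (e (i + 1)) (e (i + 2)) := fun i =>
    polyFun_order (.var i) (.var (i + 1)) (.var (i + 2))
  have hP : PolyPred fun x e => e 1 ≠ e 0 ∧
      (IsParent (e 2) (e 3) (e 4) (fun u v => x.getD (u * e 3 + v) false = true) (e 1) (e 0) ∨
        IsParent (e 2) (e 3) (e 4) (fun u v => x.getD (u * e 3 + v) false = true) (e 0) (e 1)) :=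
    (PolyPred.eq (.var 1) (.var 0)).not.and
      ((polyPred_isParent (.var 2) (.var 3) (.var 4) (.var 1) (.var 0)).or
        (polyPred_isParent (.var 2) (.var 3) (.var 4) (.var 0) (.var 1)))
  exact (Emits.unary (((PolyFun.const 4).mul (.var 0)).add (.const 4))).append
    (((Emits.unary (hN 0)).append (Emits.flatMap (hN 0) (Emits.flatMap (hN 1) 
      ((Emits.bit hP).congr fun x e => by congr)))).append
      ((Emits.flatMap (hN 0) ((Emits.binary (polyFun_weight (.var 1) (.var 2) (.var 3) (.var 0))).append
        (Emits.binary (.const 1)))).append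
        ((Emits.binary (polyFun_target (.var 0) (.var 1) (.var 2))).append (Emits.binary (.const 1)))))

end DomForest

/-! ### The reduction and its correctness -/

namespace DomForest

open StackProg

/-- The entries of the adjacency matrix, row by row. -/
noncomputable def adjBits (I : DominatingSetInst) : List Bool :=
  open Classical in
  (List.finRange I.n).flatMap fun u => (List.finRange I.n).map fun v => decide (I.G.Adj u v)

theorem getD_flatMap {ι : Type*} {n : ℕ} (l : List ι) (f : ι → List Bool)
    (hf : ∀ i, (f i).length = n) {u v : ℕ} (hu : u < l.length) (hv : v < n) :
    (l.flatMap f).getD (u * n + v) false = (f l[u]).getD v false := by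
  induction l generalizing u with
  | nil => simp at hu
  | cons a l ih =>
    rw [List.flatMap_cons]
    cases u with
    | zero => rw [List.getD_append _ _ _ _ (by rw [hf]; omega)]; simp
    | succ u =>
      rw [List.getD_append_right _ _ _ _ (by rw [hf, Nat.succ_mul]; omega), hf,
        show (u + 1) * n + v - n = u * n + v by rw [Nat.succ_mul]; omega]
      exact ih (by simpa using hu)

/-- The adjacency of the given graph, read from the adjacency matrix. -/
def AdjNat (I : DominatingSetInst) (u v : ℕ) : Prop := (adjBits I).getD (u * I.n + v) false = true

theorem adjNat_iff (I : DominatingSetInst) (u v : Fin I.n) : AdjNat I u v ↔ I.G.Adj u v := by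
  rw [AdjNat, adjBits, getD_flatMap _ _ (by simp) (by simp) v.2, List.getD_eq_getElem _ _ (by simp)]
  simp

theorem word_dominatingSet (I : DominatingSetInst) : dominatingSet.word I =
    unaryWord I.k ++ (unaryWord I.n ++ (adjBits I).map Computability.Γ'.bit) := by
  simp only [ParamProblem.word, dominatingSet, graphWord, adjBits, List.map_flatMap, List.map_map]
  rfl

theorem weight_pos (k n U : ℕ) : 0 < weight k n (blockSize k) U := by
  have h1 : ∀ j ≤ 4 * k + 4, 0 < level k n (blockSize k) j := fun j hj =>
    (Nat.succ_pos n).trans_le (le_level hj)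
  have h2 : pos k n (blockSize k) U ≠ k * n → pos k n (blockSize k) U / n < k :=
    div_lt_of_ne (pos_le U)
  rw [weight]
  split_ifs with h3 h4 h5 h6
  · exact one_pos
  · exact Nat.add_pos_left (h1 _ (by have := h2 h4; omega)) _
  · exact Nat.add_pos_left (h1 _ (by have := h2 h4; omega)) _
  · exact Nat.succ_pos _
  · exact h1 _ (padicValNat_two_lt h3 (Nat.mod_lt U (by positivity))).le

/-- The reduction from Dominating Set. -/
noncomputable def reduce (I : DominatingSetInst) : ForestColoringInst where
  n := order I.k I.n (blockSize I.k)
  G := relGraph _ (IsParent I.k I.n (blockSize I.k) (AdjNat I))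
  isAcyclic := isAcyclic (by positivity) _
  w U := weight I.k I.n (blockSize I.k) U
  w_pos U := Nat.cast_pos.2 (weight_pos _ _ _)
  r := 4 * I.k + 4
  r_pos := by omega
  M := target I.k I.n (blockSize I.k)

theorem range_flatMap {α : Type*} (n : ℕ) (f : ℕ → List α) :
    (List.range n).flatMap f = (List.finRange n).flatMap fun u : Fin n => f (u : ℕ) := by
  rw [← List.map_coe_finRange_eq_range, List.flatMap_map]

theorem ratWord_natCast (m : ℕ) : ratWord m = binaryWord m ++ binaryWord 1 := by
  rw [ratWord, NNRat.num_natCast, NNRat.den_natCast]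

theorem word_reduce (I : DominatingSetInst) : forestColoring.word (reduce I) =
    outWord (adjBits I) I.k I.n (blockSize I.k) := by
  simp only [ParamProblem.word, forestColoring, reduce, outWord, graphWord, weightsWord,
    ratWord_natCast, range_flatMap, ← List.map_eq_flatMap]
  congr 3
  congr 1
  funext U
  rw [← List.map_coe_finRange_eq_range, List.map_map]
  congr 1
  funext V
  refine congrArg Computability.Γ'.bit (decide_eq_decide.2 ?_)
  refine (SimpleGraph.fromRel_adj _ U V).trans ?_
  rw [ne_eq, Fin.ext_iff]
  rfl

/-- A set of at most `k` vertices is listed in `k` slots, with default value 0 in unused ones;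
conversely, slot values that are not vertices are dropped. -/
theorem mem_yes_iff (I : DominatingSetInst) : I ∈ dominatingSet.yes ↔
    ∃ x : ℕ → ℕ, ∀ v < I.n, ∃ i < I.k, x i < I.n ∧ (x i = v ∨ AdjNat I (x i) v) := by
  constructor
  · rintro ⟨S, hS, hdom⟩
    have hmem : ∀ u ∈ S, ∃ i < I.k, (S.toList.map Fin.val).getD i 0 = u := by
      intro u hu
      obtain ⟨i, hi, h⟩ := List.getElem_of_mem (Finset.mem_toList.2 hu)
      refine ⟨i, by rw [Finset.length_toList] at hi; omega, ?_⟩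
      rw [List.getD_eq_getElem _ _ (by simpa using hi), List.getElem_map, h]
    refine ⟨fun i => (S.toList.map Fin.val).getD i 0, fun v hv => ?_⟩
    rcases hdom ⟨v, hv⟩ with h | ⟨u, hu, h⟩
    · obtain ⟨i, hi, h1⟩ := hmem _ h
      exact ⟨i, hi, h1.trans_lt hv, Or.inl h1⟩
    · obtain ⟨i, hi, h1⟩ := hmem _ hu
      refine ⟨i, hi, h1.trans_lt u.2, Or.inr ?_⟩
      show AdjNat I ((S.toList.map Fin.val).getD i 0) v
      rw [h1]
      exact (adjNat_iff I u ⟨v, hv⟩).2 h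
  · rintro ⟨x, hx⟩
    refine ⟨Finset.univ.filter fun u : Fin I.n => (u : ℕ) ∈ (Finset.range I.k).image x, ?_, fun v => ?_⟩
    · rw [← Finset.card_map Fin.valEmbedding]
      refine (Finset.card_le_card fun u hu => ?_).trans
        ((Finset.card_image_le (f := x)).trans (Finset.card_range I.k).le)
      obtain ⟨w, hw, rfl⟩ := Finset.mem_map.1 hu
      exact (Finset.mem_filter.1 hw).2
    · obtain ⟨i, hi, h1, h2⟩ := hx v v.2
      have h3 : (⟨x i, h1⟩ : Fin I.n) ∈
          Finset.univ.filter fun u : Fin I.n => (u : ℕ) ∈ (Finset.range I.k).image x :=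
        Finset.mem_filter.2 ⟨Finset.mem_univ _,
          Finset.mem_image_of_mem _ (Finset.mem_range.2 hi)⟩
      rcases h2 with h2 | h2
      · exact Or.inl ((Fin.ext h2 : (⟨x i, h1⟩ : Fin I.n) = v) ▸ h3)
      · exact Or.inr ⟨_, h3, (adjNat_iff I ⟨x i, h1⟩ v).1 h2⟩

theorem isReduction_reduce : dominatingSet.IsReduction forestColoring reduce where
  equivalent I := by
    refine Iff.trans ?_ ((sigma_le_target_iff (A := AdjNat I) rfl).trans (mem_yes_iff I).symm)
    change sigma _ (fun U : Fin (order I.k I.n (blockSize I.k)) => (((weight I.k I.n (blockSize I.k) (U : ℕ) : ℕ) : ℚ≥0) : ℝ≥0)) _ ≤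
      (((target I.k I.n (blockSize I.k) : ℕ) : ℚ≥0) : ℝ≥0) ↔ _
    simp only [NNRat.cast_natCast]
    rfl
  param_le := ⟨fun k => 4 * k + 4, (Primrec.nat_add.comp (Primrec.nat_mul.comp (.const 4) .id)
    (.const 4)).to_comp, fun _ => le_rfl⟩
  fpt_time := by
    obtain ⟨c, h, D, hh, hc⟩ := emits_outWord.exists_machine
    refine ⟨⟨c.toMachine, Equiv.refl Computability.Γ', Equiv.refl Computability.Γ'⟩, h, D, hh,
      fun I => ?_⟩
    have h1 (J : DominatingSetInst) : Nonempty (Turing.TM2OutputsInTime c.toMachine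
        (dominatingSet.word J) (some (forestColoring.word (reduce J)))
        (h J.k * (dominatingSet.word J).length ^ D)) := by
      have h2 := hc J.k J.n (adjBits J)
      have h3 : (16 : ℕ) ^ (J.k + 1) = blockSize J.k := by
        rw [show (16 : ℕ) = 2 ^ 4 by norm_num, ← pow_mul]
        rfl
      simp only [headerNum, cons, h3] at h2
      rwa [word_dominatingSet, word_reduce]
    -- The words occur in the type of the computation, so they are generalized before the identity
    -- maps of the alphabets are removed.
    have h4 (a b : List Computability.Γ') (ha : a = dominatingSet.word I)
        (hb : b = forestColoring.word (reduce I)) :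
        Nonempty (Turing.TM2OutputsInTime c.toMachine a (some b)
          (h (dominatingSet.param I) * dominatingSet.size I ^ D)) := by
      subst ha hb
      exact h1 I
    exact h4 _ _ (List.map_id _) (List.map_id _)

end DomForest

theorem theorem2 :
    W2Hard forestColoring ∧
    ∃ f : dominatingSet.Inst → forestColoring.Inst,
      dominatingSet.IsReduction forestColoring f ∧
      ∀ I : dominatingSet.Inst,
        forestColoring.param (f I) = 4 * dominatingSet.param I + 4 :=
  ⟨⟨_, DomForest.isReduction_reduce⟩, _, DomForest.isReduction_reduce, fun _ => rfl⟩
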